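/- Let $\rho$ be a quantum state (density matrix) of arbitrary finite dimension and of known rank $r\ge 2$, let $k\ge 1$ be an integer, $0<\epsilon\le 1$ and $0<\delta<1$. Given real estimates $Q_1,\dots,Q_r$ of $\mathrm{Tr}(\rho),\dots,\mathrm{Tr}(\rho^r)$, put $b_0=1$, $b_m=\frac1m\sum_{\ell=1}^m(-1)^{\ell-1}b_{m-\ell}Q_\ell$ for $1\le m\le r$, and $Q_n=\sum_{j=1}^r(-1)^{j-1}b_jQ_{n-j}$ for $n>r$. (i) (Sufficiency.) If $|Q_j-\mathrm{Tr}(\rho^j)|<\dfrac{\epsilon}{k\,r\ln r}$ for all $1\le j\le r$, then $|Q_i-\mathrm{Tr}(\rho^i)|<\epsilon$ for all $1\le i\le k$. (ii) (Resources.) There are quantum circuits $\mathcal C_1,\mathcal C_2,\dots$, independent of $\rho$, with the following properties. The circuit $\mathcal C_j$ acts on $j$ copies of $\rho$ and on ancilla qubits initialised to $|0\rangle$, has constant quantum depth (independent of $j$), uses $O(j)$ ancilla qubits (so $O(j)$ qubits in total for states of a fixed number of qubits, and $nj+O(j)$ qubits if each copy occupies $n$ qubits) and $O(j)$ controlled swaps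 (CSWAPs) of two copies. Besides CSWAPs it contains only Hadamard gates, CNOT gates, mid-circuit measurements, and Pauli $X$ gates controlled by parities of earlier measurement outcomes; one run yields a value $\pm1$, determined by the parity of some measurement outcomes. For every $r,k,\epsilon,\delta$ as above there is a number $N$, the same for all $j$ and depending only on $r,k,\epsilon,\delta$, with $$N=O\!\left(\frac{k^2r^2\ln^2 r}{\epsilon^2}\,\ln\frac1\delta\right),$$ such that the following holds for every state $\rho$ of rank $r$. Run $\mathcal C_j$ independently $N$ times for each $j=1,\dots,r$, and let $Q_j$ be the mean of the $N$ values obtained. Then, for each $j\le r$, $|Q_j-\mathrm{Tr}(\rho^j)|<\epsilon/(k\,r\ln r)$ with probability at least $1-\delta$; and, with probability at least $1-\delta$, $|Q_i-\mathrm{Tr}(\rho^i)|<\epsilon$ holds simultaneously for all $1\le i\le k$. The total number of copies of $\rho$ that are used is $$\sum_{j=1}^r jN=O\!\left(\frac{k^2r^4\ln^2 r}{\epsilon^2}\,\ln\frac1\delta\right),$$ that is, $O(k^2r^4\ln^2 r/\epsilon^2)$ for fixed $\delta$. The constants in the bounds on the circuits are absolute. Those in the bounds on $N$ and on the number of copies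 are uniform in $r,k,\epsilon,\rho$ (and its dimension) and in $\delta\in(0,\delta_0]$, for every fixed $\delta_0<1$. -/

import Mathlib

open scoped Matrix ENNReal ComplexOrder

/-! ## Quantum states -/

/-- A quantum state on a `d`-dimensional system: a positive semidefinite matrix of trace one. -/
structure DensityMatrix (d : ℕ) where
  mat : Matrix (Fin d) (Fin d) ℂ
  posSemidef : mat.PosSemidef
  trace_eq_one : mat.trace = 1

namespace DensityMatrix

/-- The rank of the state. -/
noncomputable def rank {d : ℕ} (ρ : DensityMatrix d) : ℕ := ρ.mat.rank

/-- `Tr(ρ ^ i)`, which is a real number. -/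
noncomputable def powTrace {d : ℕ} (ρ : DensityMatrix d) (i : ℕ) : ℝ := ((ρ.mat ^ i).trace).re

end DensityMatrix

/-! ## Circuits

A circuit for `m` copies of a `d`-dimensional state acts on `a` ancilla qubits, initially `|0⟩`, and
on `m` registers of dimension `d`, each of which initially holds one copy of the state. It has a
classical memory of `c` bits, initially `0`, which stores the outcomes of mid-circuit measurements. -/

namespace QCircuit

/-- The elementary operations. -/
inductive Op (a c m : ℕ) : Type
  /-- The Hadamard gate on one qubit. -/
  | hadamard (q : Fin a) : Op a c m
  /-- The controlled-NOT gate on two qubits. -/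
  | cnot (control target : Fin a) (h : control ≠ target) : Op a c m
  /-- Controlled on a qubit, swap two registers. -/
  | cswap (control : Fin a) (u v : Fin m) (h : u ≠ v) : Op a c m
  /-- Classical feedback: apply Pauli `X` to a qubit if the parity of the given classical bits
  is odd. -/
  | condX (q : Fin a) (s : Finset (Fin c)) : Op a c m
  /-- Measure a qubit in the computational basis and store the outcome in a classical bit. -/
  | measure (q : Fin a) (k : Fin c) : Op a c m

variable {a c m : ℕ}

namespace Op

/-- The qubits on which an operation acts. -/
def qubits : Op a c m → Finset (Fin a)
  | hadamard q => {q}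
  | cnot p q _ => {p, q}
  | cswap q _ _ _ => {q}
  | condX q _ => {q}
  | measure q _ => {q}

/-- The registers on which an operation acts. -/
def registers : Op a c m → Finset (Fin m)
  | cswap _ u v _ => {u, v}
  | _ => ∅

/-- The classical bits which an operation reads. -/
def reads : Op a c m → Finset (Fin c)
  | condX _ s => s
  | _ => ∅

/-- The classical bits which an operation writes. -/
def writes : Op a c m → Finset (Fin c)
  | measure _ k => {k}
  | _ => ∅

/-- Is the operation a `CSWAP`? -/
def isCSwap : Op a c m → Bool
  | cswap _ _ _ _ => true
  | _ => false

/-- Two operations can be carried out at the same time: they act on different qubits and registers,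
and neither writes a classical bit that the other one reads or writes. -/
def Parallel (x y : Op a c m) : Prop :=
  Disjoint x.qubits y.qubits ∧ Disjoint x.registers y.registers ∧
    Disjoint x.writes (y.reads ∪ y.writes) ∧ Disjoint y.writes (x.reads ∪ x.writes)

end Op

end QCircuit

/-- A circuit which consumes `m` copies of a state. It is a list of layers; the operations of one
layer are carried out at the same time. The result of a run is the parity of some of the classical
bits. -/
structure QCircuit (m : ℕ) where
  /-- the number of ancilla qubits -/
  ancillas : ℕ
  /-- the number of classical bits -/
  cbits : ℕ
  layers : List (List (QCircuit.Op ancillas cbits m))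
  parallel : ∀ L ∈ layers, L.Pairwise QCircuit.Op.Parallel
  /-- the classical bits whose parity is the result -/
  output : Finset (Fin cbits)

namespace QCircuit

section Resources

variable {m : ℕ}

/-- The quantum depth: the number of layers. -/
def depth (C : QCircuit m) : ℕ := C.layers.length

/-- The number of `CSWAP` operations. -/
def cswapCount (C : QCircuit m) : ℕ := C.layers.flatten.countP Op.isCSwap

/-- The total number of qubits if each copy of the state occupies `n` qubits. -/
def numQubits (C : QCircuit m) (n : ℕ) : ℕ := C.ancillas + m * n

end Resources

section Semantics

variable {a c m d : ℕ}

/-- Computational basis of the ancilla qubits and the registers. -/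
abbrev Basis (a m d : ℕ) : Type := (Fin a → Bool) × (Fin m → Fin d)

/-- Operators on the joint space of the ancilla qubits and the registers. -/
abbrev Operator (a m d : ℕ) : Type := Matrix (Basis a m d) (Basis a m d) ℂ

/-- A state of qubits, registers and classical memory: for each content of the memory the
unnormalized state of the quantum systems, whose trace is the probability of that content. -/
abbrev HybridState (a c m d : ℕ) : Type := (Fin c → Bool) → Operator a m d

/-- The operator that maps each basis vector `|x⟩` to `|f x⟩`. -/
def basisMap (f : Basis a m d → Basis a m d) : Operator a m d :=
  Matrix.of fun x y => if x = f y then 1 else 0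

/-- Action of `X` on the basis. -/
def xFun (q : Fin a) (x : Basis a m d) : Basis a m d :=
  (Function.update x.1 q (!x.1 q), x.2)

/-- Action of `CNOT` on the basis. -/
def cnotFun (p q : Fin a) (x : Basis a m d) : Basis a m d :=
  (Function.update x.1 q (xor (x.1 p) (x.1 q)), x.2)

/-- Action of `CSWAP` on the basis. -/
def cswapFun (q : Fin a) (u v : Fin m) (x : Basis a m d) : Basis a m d :=
  (x.1, if x.1 q then x.2 ∘ Equiv.swap u v else x.2)

/-- The Hadamard gate on qubit `q`: `H|v⟩ = (|0⟩ + (-1)^v |1⟩) / √2`. -/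
noncomputable def hadamardOp (q : Fin a) : Operator a m d :=
  Matrix.of fun x y =>
    if Function.update x.1 q (y.1 q) = y.1 ∧ x.2 = y.2 then
      (if x.1 q && y.1 q then -1 else 1) / (Real.sqrt 2 : ℂ)
    else 0

/-- The projection onto the basis vectors on which qubit `q` has value `v`. -/
def projOp (q : Fin a) (v : Bool) : Operator a m d :=
  Matrix.diagonal fun x => if x.1 q = v then 1 else 0

/-- The parity of the bits of `b` at the places in `s`; `true` means odd. -/
def parity (s : Finset (Fin c)) (b : Fin c → Bool) : Bool :=
  decide (Odd (s.filter fun i => b i = true).card)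

/-- The effect of one operation. A measurement leads from memory content `b'` to the contents
`b` that differ from `b'` at most in bit `k`, and projects onto the outcome `b k`. -/
noncomputable def Op.apply (o : Op a c m) (σ : HybridState a c m d) : HybridState a c m d :=
  match o with
  | .hadamard q => fun b => hadamardOp q * σ b * (hadamardOp q)ᴴ
  | .cnot p q _ => fun b => basisMap (cnotFun p q) * σ b * (basisMap (cnotFun p q))ᴴ
  | .cswap q u v _ => fun b => basisMap (cswapFun q u v) * σ b * (basisMap (cswapFun q u v))ᴴ
  | .condX q s => fun b =>
      if parity s b then basisMap (xFun q) * σ b * (basisMap (xFun q))ᴴ else σ b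
  | .measure q k => fun b =>
      ∑ w : Bool, projOp q (b k) * σ (Function.update b k w) * (projOp q (b k))ᴴ

/-- The initial state: ancilla qubits `|0⟩`, registers `ρ ⊗ ⋯ ⊗ ρ`, memory `0`. -/
noncomputable def initState (a c m : ℕ) (ρ : DensityMatrix d) : HybridState a c m d := fun b =>
  if b = fun _ => false then
    Matrix.of fun x y =>
      if (x.1 = fun _ => false) ∧ (y.1 = fun _ => false) then ∏ i, ρ.mat (x.2 i) (y.2 i) else 0
  else 0

/-- The state after all layers have been carried out, in order. -/
noncomputable def finalState {m : ℕ} (C : QCircuit m) (ρ : DensityMatrix d) :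
    HybridState C.ancillas C.cbits m d :=
  C.layers.flatten.foldl (fun σ o => o.apply σ) (initState C.ancillas C.cbits m ρ)

/-! ### The final state is normalized -/

/-- All parts of a hybrid state are positive semidefinite and the traces add up to one. -/
def IsNormalized (σ : HybridState a c m d) : Prop :=
  (∀ b, (σ b).PosSemidef) ∧ ∑ b, (σ b).trace = 1

theorem trace_conj_unitary {U A : Operator a m d} (hU : Uᴴ * U = 1) :
    (U * A * Uᴴ).trace = A.trace := by
  rw [Matrix.trace_mul_comm, ← Matrix.mul_assoc, hU, Matrix.one_mul]

theorem basisMap_unitary {f : Basis a m d → Basis a m d} (hf : Function.Involutive f) :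
    (basisMap f)ᴴ * basisMap f = 1 := by
  ext x y
  simp only [Matrix.mul_apply, Matrix.conjTranspose_apply, basisMap, Matrix.of_apply,
    Matrix.one_apply]
  rw [Finset.sum_eq_single (f y)]
  · by_cases h : x = y
    · simp [h]
    · simp [h, hf.injective.eq_iff, Ne.symm h]
  · intro z _ hz
    simp [hz]
  · simp

theorem xFun_involutive (q : Fin a) : Function.Involutive (xFun (m := m) (d := d) q) := by
  intro x
  simp [xFun]

theorem cnotFun_involutive {p q : Fin a} (h : p ≠ q) :
    Function.Involutive (cnotFun (m := m) (d := d) p q) := by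
  intro x
  simp [cnotFun, h]

theorem cswapFun_involutive (q : Fin a) (u v : Fin m) :
    Function.Involutive (cswapFun (d := d) q u v) := by
  intro x
  by_cases h : x.1 q = true
  · ext i <;> simp [cswapFun, h]
  · simp [cswapFun, h]

theorem hadamard_unitary (q : Fin a) :
    (hadamardOp (m := m) (d := d) q)ᴴ * hadamardOp q = 1 := by
  have h2 : (Real.sqrt 2 : ℂ) * (Real.sqrt 2 : ℂ) = 2 := by
    rw [← Complex.ofReal_mul, Real.mul_self_sqrt (by norm_num)]
    norm_num
  have h0 : (Real.sqrt 2 : ℂ) ≠ 0 := by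
    intro h
    rw [h] at h2
    norm_num at h2
  ext x y
  simp only [Matrix.mul_apply, Matrix.conjTranspose_apply, hadamardOp, Matrix.of_apply,
    Matrix.one_apply]
  rw [Finset.sum_eq_add (Function.update x.1 q false, x.2) (Function.update x.1 q true, x.2)]
  · by_cases hy : x.2 = y.2 ∧ Function.update x.1 q (y.1 q) = y.1
    · obtain ⟨hy1, hy2⟩ := hy
      by_cases hq : x.1 q = y.1 q
      · have hxy : x = y := by
          refine Prod.ext ?_ hy1
          rw [← hy2, ← hq, Function.update_eq_self]
        subst hxy
        cases hx : x.1 q <;> simp [← hx] <;> simp [hx] <;> field_simp <;> linear_combination -h2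
      · have hxy : x ≠ y := fun h => hq (by rw [h])
        have hy3 : ∀ w, y.1 q = w → Function.update x.1 q w = y.1 := by
          rintro w rfl
          exact hy2
        have hy4 : ∀ w, x.1 q = w → Function.update y.1 q w = x.1 := by
          rintro w rfl
          rw [← hy2]
          simp
        have hp : (starRingEnd ℂ) (Real.sqrt 2 : ℂ) = Real.sqrt 2 := Complex.conj_ofReal _
        cases hx : x.1 q <;> cases hz : y.1 q <;>
          simp_all [hy3 _ hz, hy4 _ hx] <;> field_simp <;> ring
    · have hxy : x ≠ y := by
        rintro rfl
        simp at hy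
      by_cases h1 : x.2 = y.2
      · have h3 : Function.update x.1 q (y.1 q) ≠ y.1 := fun h => hy ⟨h1, h⟩
        simp [hxy, h3]
      · simp [hxy, h1]
  · intro h
    have := congrFun (congrArg Prod.fst h) q
    simp at this
  · rintro z - ⟨hz1, hz2⟩
    by_cases h : Function.update z.1 q (x.1 q) = x.1 ∧ z.2 = x.2
    · exfalso
      obtain ⟨h3, h4⟩ := h
      have h5 : ∀ w, z.1 q = w → z = (Function.update x.1 q w, x.2) := by
        rintro w rfl
        refine Prod.ext ?_ h4
        rw [← h3]
        simp
      cases hw : z.1 q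
      · exact hz1 (h5 _ hw)
      · exact hz2 (h5 _ hw)
    · simp [h]
  · simp
  · simp

theorem sum_projOp (q : Fin a) :
    ∑ v : Bool, (projOp (m := m) (d := d) q v)ᴴ * projOp q v = 1 := by
  ext x y
  by_cases h : x = y
  · subst h
    cases hx : x.1 q <;> simp [projOp, Matrix.diagonal_conjTranspose, hx]
  · simp [projOp, Matrix.diagonal_conjTranspose, h]

theorem sum_update (k : Fin c) (F : (Fin c → Bool) → Bool → ℂ) :
    ∑ b, ∑ w : Bool, F (Function.update b k w) (b k) = ∑ b, ∑ v : Bool, F b v := by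
  rw [← Fintype.sum_prod_type', ← Fintype.sum_prod_type']
  refine Fintype.sum_bijective
    (fun p : (Fin c → Bool) × Bool => (Function.update p.1 k p.2, p.1 k)) ?_ _ _ fun _ => rfl
  refine Function.Involutive.bijective fun p => ?_
  simp

theorem isNormalized_apply (o : Op a c m) {σ : HybridState a c m d} (h : IsNormalized σ) :
    IsNormalized (o.apply σ) := by
  obtain ⟨h1, h2⟩ := h
  cases o with
  | hadamard q =>
    refine ⟨fun b => (h1 b).mul_mul_conjTranspose_same _, ?_⟩
    simpa only [Op.apply, trace_conj_unitary (hadamard_unitary q)] using h2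
  | cnot p q hpq =>
    refine ⟨fun b => (h1 b).mul_mul_conjTranspose_same _, ?_⟩
    simpa only [Op.apply, trace_conj_unitary (basisMap_unitary (cnotFun_involutive hpq))] using h2
  | cswap q u v _ =>
    refine ⟨fun b => (h1 b).mul_mul_conjTranspose_same _, ?_⟩
    simpa only [Op.apply, trace_conj_unitary (basisMap_unitary (cswapFun_involutive q u v))]
      using h2
  | condX q s =>
    refine ⟨fun b => ?_, ?_⟩
    · simp only [Op.apply]
      split_ifs
      · exact (h1 b).mul_mul_conjTranspose_same _
      · exact h1 b
    · rw [← h2]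
      refine Finset.sum_congr rfl fun b _ => ?_
      simp only [Op.apply]
      split_ifs
      · exact trace_conj_unitary (basisMap_unitary (xFun_involutive q))
      · rfl
  | measure q k =>
    refine ⟨fun b => Matrix.posSemidef_sum _ fun w _ => (h1 _).mul_mul_conjTranspose_same _, ?_⟩
    simp only [Op.apply, Matrix.trace_sum]
    refine (sum_update k fun b v => (projOp q v * σ b * (projOp q v)ᴴ).trace).trans ?_
    rw [← h2]
    refine Finset.sum_congr rfl fun b _ => ?_
    have : ∀ v, (projOp q v * σ b * (projOp q v)ᴴ).trace
        = ((projOp q v)ᴴ * projOp q v * σ b).trace := fun v => by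
      rw [Matrix.trace_mul_comm, ← Matrix.mul_assoc]
    simp only [this]
    rw [← Matrix.trace_sum, ← Finset.sum_mul, sum_projOp, Matrix.one_mul]

open scoped MatrixOrder Matrix.Norms.L2Operator in
theorem exists_factor {n : ℕ} {A : Matrix (Fin n) (Fin n) ℂ} (hA : A.PosSemidef) :
    ∃ B : Matrix (Fin n) (Fin n) ℂ, A = Bᴴ * B :=
  CStarAlgebra.nonneg_iff_eq_star_mul_self.mp hA.nonneg

theorem isNormalized_initState (ρ : DensityMatrix d) : IsNormalized (initState a c m ρ) := by
  constructor
  · intro b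
    unfold initState
    split_ifs
    · obtain ⟨B, hB⟩ := exists_factor ρ.posSemidef
      have key : (Matrix.of fun x y : Basis a m d =>
          if (x.1 = fun _ => false) ∧ (y.1 = fun _ => false) then
            ∏ i, ρ.mat (x.2 i) (y.2 i) else 0)
          = (Matrix.of fun (w : Fin m → Fin d) (x : Basis a m d) =>
              if (x.1 = fun _ => false) then ∏ i, B (w i) (x.2 i) else 0)ᴴ *
            (Matrix.of fun (w : Fin m → Fin d) (x : Basis a m d) =>
              if (x.1 = fun _ => false) then ∏ i, B (w i) (x.2 i) else 0) := by
        ext x y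
        simp only [Matrix.mul_apply, Matrix.conjTranspose_apply, Matrix.of_apply]
        by_cases hx : x.1 = fun _ => false
        · by_cases hy : y.1 = fun _ => false
          · simp only [hx, hy, and_self, if_true, hB, Matrix.mul_apply,
              Matrix.conjTranspose_apply, star_prod, ← Finset.prod_mul_distrib]
            rw [Finset.prod_univ_sum]
            simp
          · simp [hy]
        · simp [hx]
      rw [key]
      exact Matrix.posSemidef_conjTranspose_mul_self _
    · exact Matrix.PosSemidef.zero
  · rw [Finset.sum_eq_single fun _ => false]
    · simp only [initState, if_true, Matrix.trace, Matrix.diag_apply, Matrix.of_apply, and_self]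
      rw [Fintype.sum_prod_type, Finset.sum_eq_single fun _ => false]
      · simp only [if_true]
        have := Finset.prod_univ_sum (fun _ : Fin m => (Finset.univ : Finset (Fin d)))
          (fun _ u => ρ.mat u u)
        rw [Fintype.piFinset_univ] at this
        rw [← this]
        have h1 : ∑ u, ρ.mat u u = 1 := ρ.trace_eq_one
        simp [h1]
      · intro x _ hx
        simp [hx]
      · simp
    · intro b _ hb
      simp [initState, hb]
    · simp

theorem isNormalized_finalState {m : ℕ} (C : QCircuit m) (ρ : DensityMatrix d) :
    IsNormalized (C.finalState ρ) := by
  unfold finalState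
  generalize C.layers.flatten = l
  have h := isNormalized_initState (a := C.ancillas) (c := C.cbits) (m := m) ρ
  revert h
  generalize initState C.ancillas C.cbits m ρ = σ
  induction l generalizing σ with
  | nil => exact id
  | cons o l ih => exact fun h => ih _ (isNormalized_apply o h)

theorem sum_outcomeProb {m : ℕ} (C : QCircuit m) (ρ : DensityMatrix d) :
    ∑ b, ENNReal.ofReal ((C.finalState ρ b).trace).re = 1 := by
  obtain ⟨h1, h2⟩ := isNormalized_finalState C ρ
  rw [← ENNReal.ofReal_sum_of_nonneg fun b _ => ?_]
  · rw [← Complex.re_sum, h2]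
    simp
  · exact (Complex.le_def.mp (h1 b).trace_nonneg).1

/-- The distribution of the content of the classical memory after one run on copies of `ρ`. -/
noncomputable def memoryPMF {m : ℕ} (C : QCircuit m) (ρ : DensityMatrix d) :
    PMF (Fin C.cbits → Bool) :=
  PMF.ofFintype (fun b => ENNReal.ofReal ((C.finalState ρ b).trace).re) (sum_outcomeProb C ρ)

/-- The distribution of the result of one run on copies of `ρ`. -/
noncomputable def runPMF {m : ℕ} (C : QCircuit m) (ρ : DensityMatrix d) : PMF Bool :=
  (C.memoryPMF ρ).map (parity C.output)

end Semantics

end QCircuit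

/-! ## The estimation procedure -/

/-- The elementary symmetric polynomials `b_k` computed from power sums `Q_1, Q_2, …` by the
Newton-Girard formula `b_0 = 1`, `b_k = (1/k) ∑_{l=1}^k (-1)^(l-1) b_{k-l} Q_l`. -/
noncomputable def newtonGirard (Q : ℕ → ℝ) : ℕ → ℝ
  | 0 => 1
  | k + 1 => (1 / ((k : ℝ) + 1)) *
      ∑ l : Fin (k + 1), (-1) ^ (l : ℕ) * newtonGirard Q (k - l) * Q (l + 1)
termination_by k => k
decreasing_by omega

/-- The sequence that agrees with `Q` up to index `t` and is continued by the recurrence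
`Q_n = ∑_{j=1}^t (-1)^(j-1) b_j Q_{n-j}`. -/
noncomputable def extendPowerSums (t : ℕ) (Q : ℕ → ℝ) (n : ℕ) : ℝ :=
  if n ≤ t then Q n
  else ∑ j : Fin t, (-1) ^ (j : ℕ) * newtonGirard Q (j + 1) * extendPowerSums t Q (n - (j + 1))
termination_by n
decreasing_by omega

/-- The value `±1` that belongs to the result of a run. -/
def signValue (x : Bool) : ℝ := if x then -1 else 1

/-- The outcomes of `N` runs of the `j`-th circuit, for each `j = 1, …, r`; index `j : Fin r` stands
for the circuit on `j + 1` copies. -/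
abbrev Outcomes (r N : ℕ) : Type := Fin r → Fin N → Bool

/-- The law of the outcomes: all runs are independent and use fresh copies of `ρ`. -/
noncomputable def runsMeasure (circ : ∀ j : ℕ, QCircuit j) {d : ℕ} (ρ : DensityMatrix d)
    (r N : ℕ) : MeasureTheory.Measure (Outcomes r N) :=
  MeasureTheory.Measure.pi fun j => MeasureTheory.Measure.pi fun _ =>
    ((circ ((j : ℕ) + 1)).runPMF ρ).toMeasure

/-- The estimate of `Tr(ρ ^ j)`, `1 ≤ j ≤ r`: the mean of the `N` values of the `j`-th circuit
(and `0` at other indices). -/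
noncomputable def empiricalPowTrace {r N : ℕ} (ω : Outcomes r N) (j : ℕ) : ℝ :=
  if h : 1 ≤ j ∧ j ≤ r then (∑ i : Fin N, signValue (ω ⟨j - 1, by omega⟩ i)) / N else 0

/-! Sufficiency. Let `E = ∏ (1 - λ_a X)` over the nonzero eigenvalues, `H` its inverse and `P` the
series of the power sums; then `X E' = -E P`. Let `G = ∑_{m ≤ r} (-1)^m b_m X^m`. The Newton-Girard
formula in degrees up to `r` and the recurrence in higher degrees together say `X G' = -G T`, where
`T` is the series of the continued estimates. Hence `U = G H` satisfies `X U' = -U (T - P)`, that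
is, `n U_n = -∑_{i < n} U_i f_{n-i}` with the errors `f`.

Read forwards, this bounds the `U_i` with `i ≤ r` by the given errors (`sum_abs_le_prod`). For `n >
r`, `U_n` is a combination of `U_1, …, U_r` whose coefficients are, up to sign, hook Schur
polynomials (`coeff_quot_of_lt`); these lie in `[0, 1]` because the eigenvalues are nonnegative with
sum one (`abs_hook_le_one`). So one `S` bounds all `|U_n|`, `n ≥ 1`. Read backwards, the recurrence
then gives `|f_n| ≤ (1 + S)^n - 1` (`abs_le_pow_sub_one`), where `1 + S ≤ exp (η (1 + log r))`. This
settles rank at least three; rank two needs sharper constants.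

Circuits. A cat state on `n + 1` qubits is made in constant depth by measuring the parities of
neighbouring qubits and correcting with `X`. It controls a cyclic shift of the `n` copies, which is
a product of two involutions and so takes two layers of disjoint swaps. The parity of an `X`
measurement of the cat then has expectation `Tr(ρ^n)` (`unbiased_cycleCircuit`).

Statistics. Hoeffding's inequality controls each estimate. For the simultaneous claim, the stability
bound tolerates an accuracy of order `ε / (k log r)`, so the union bound over `r` circuits costs no
further logarithm (`exists_numRuns`). -/

/-! ## Elementary and complete homogeneous symmetric polynomials as power series -/

namespace SymmSeries

open PowerSeries

variable {ι : Type*}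

/-- The series `∏ (1 - λ_a X)`; its coefficients are the signed elementary symmetric polynomials. -/
noncomputable def elem (lam : ι → ℝ) (s : Finset ι) : PowerSeries ℝ :=
  ∏ a ∈ s, (1 - C (lam a) * X)

/-- The series of the complete homogeneous symmetric polynomials. -/
noncomputable def compl (lam : ι → ℝ) (s : Finset ι) : PowerSeries ℝ :=
  ∏ a ∈ s, PowerSeries.mk fun n => lam a ^ n

/-- The series `∑_{n ≥ 1} p_n X ^ n` of the power sums. -/
noncomputable def psum (lam : ι → ℝ) (s : Finset ι) : PowerSeries ℝ :=
  PowerSeries.mk fun n => if n = 0 then 0 else ∑ a ∈ s, lam a ^ n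

theorem one_sub_mul_geom (x : ℝ) :
    (1 - C x * X) * PowerSeries.mk (fun n => x ^ n) = 1 := by
  ext n
  cases n with
  | zero => simp [sub_mul, mul_assoc]
  | succ n =>
    rw [sub_mul, one_mul, mul_assoc, map_sub, coeff_C_mul, coeff_succ_X_mul]
    simp [coeff_one, pow_succ, mul_comm]

theorem elem_mul_compl (lam : ι → ℝ) (s : Finset ι) : elem lam s * compl lam s = 1 := by
  rw [elem, compl, ← Finset.prod_mul_distrib]
  exact Finset.prod_eq_one fun a _ => one_sub_mul_geom _

theorem constCoeff_elem (lam : ι → ℝ) (s : Finset ι) : coeff 0 (elem lam s) = 1 := by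
  rw [coeff_zero_eq_constantCoeff_apply, elem, map_prod]
  simp

theorem constCoeff_compl (lam : ι → ℝ) (s : Finset ι) : coeff 0 (compl lam s) = 1 := by
  rw [coeff_zero_eq_constantCoeff_apply, compl, map_prod]
  simp

section Insert

variable [DecidableEq ι] (lam : ι → ℝ) {a : ι} {s : Finset ι}

theorem elem_insert (ha : a ∉ s) :
    elem lam (insert a s) = elem lam s - C (lam a) * (X * elem lam s) := by
  rw [elem, Finset.prod_insert ha, ← elem]
  ring

theorem coeff_succ_elem_insert (ha : a ∉ s) (n : ℕ) :
    coeff (n + 1) (elem lam (insert a s)) =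
      coeff (n + 1) (elem lam s) - lam a * coeff n (elem lam s) := by
  rw [elem_insert lam ha, map_sub, coeff_C_mul, coeff_succ_X_mul]

theorem compl_insert (ha : a ∉ s) :
    compl lam (insert a s) = compl lam s + C (lam a) * (X * compl lam (insert a s)) := by
  have h := one_sub_mul_geom (lam a)
  rw [compl, Finset.prod_insert ha, ← compl]
  linear_combination (compl lam s) * h

theorem coeff_succ_compl_insert (ha : a ∉ s) (n : ℕ) :
    coeff (n + 1) (compl lam (insert a s)) =
      coeff (n + 1) (compl lam s) + lam a * coeff n (compl lam (insert a s)) := by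
  conv_lhs => rw [compl_insert lam ha, map_add, coeff_C_mul, coeff_succ_X_mul]

end Insert

theorem coeff_elem_of_card_lt (lam : ι → ℝ) (s : Finset ι) :
    ∀ n, s.card < n → coeff n (elem lam s) = 0 := by
  classical
  induction s using Finset.induction_on with
  | empty =>
    intro n hn
    rw [elem, Finset.prod_empty, coeff_one, if_neg (by simp at hn; omega)]
  | insert a s ha ih =>
    intro n hn
    rw [Finset.card_insert_of_notMem ha] at hn
    obtain ⟨n, rfl⟩ : ∃ m, n = m + 1 := ⟨n - 1, by omega⟩
    rw [coeff_succ_elem_insert lam ha, ih _ (by omega), ih _ (by omega)]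
    simp

/-- Logarithmic derivative: `-X (log (1 - λ X))' = ∑_{n ≥ 1} λ^n X^n`, added up over the factors and
multiplied out. These are all of Newton's identities in one equation. -/
theorem X_mul_derivative_elem (lam : ι → ℝ) (s : Finset ι) :
    X * derivative ℝ (elem lam s) = -(elem lam s * psum lam s) := by
  classical
  induction s using Finset.induction_on with
  | empty =>
    have : psum lam ∅ = 0 := by ext n; simp [psum]
    simp [elem, this]
  | insert a s ha ih =>
    have h1 : psum lam (insert a s) =
        psum lam s + C (lam a) * (X * PowerSeries.mk fun n => lam a ^ n) := by
      ext n
      cases n with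
      | zero => simp [psum]
      | succ n =>
        simp [psum, Finset.sum_insert ha, coeff_succ_X_mul, pow_succ, mul_comm, add_comm]
    have h2 := one_sub_mul_geom (lam a)
    have h3 : derivative ℝ (C (lam a) * X) = C (lam a) := by
      ext n
      simp [derivative_C]
    rw [h1]
    rw [elem, Finset.prod_insert ha, ← elem, Derivation.leibniz, map_sub, h3]
    simp only [smul_eq_mul, Derivation.map_one_eq_zero, zero_sub]
    linear_combination (1 - C (lam a) * X) * ih + elem lam s * C (lam a) * X * h2

/-! ### Bounds for nonnegative variables, in particular for hooks -/

section Bounds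

variable {lam : ι → ℝ}

theorem coeff_compl_nonneg (hlam : ∀ a, 0 ≤ lam a) (s : Finset ι) (n : ℕ) :
    0 ≤ coeff n (compl lam s) := by
  classical
  induction s using Finset.induction_on generalizing n with
  | empty => rw [compl, Finset.prod_empty, coeff_one]; split_ifs <;> simp
  | insert a s ha ih =>
    induction n with
    | zero => rw [constCoeff_compl]; simp
    | succ n ih' =>
      rw [coeff_succ_compl_insert lam ha]
      exact add_nonneg (ih _) (mul_nonneg (hlam a) ih')

/-- Each monomial of degree `n` occurs in the expansion of `(∑ λ_a)^n` with coefficient at least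
one. -/
theorem coeff_compl_le (hlam : ∀ a, 0 ≤ lam a) (s : Finset ι) (n : ℕ) :
    coeff n (compl lam s) ≤ (∑ a ∈ s, lam a) ^ n := by
  classical
  induction s using Finset.induction_on generalizing n with
  | empty =>
    rw [compl, Finset.prod_empty, coeff_one]
    split_ifs with h <;> simp [h]
  | insert a s ha ih =>
    have h0 : 0 ≤ ∑ a ∈ s, lam a := Finset.sum_nonneg fun a _ => hlam a
    rw [Finset.sum_insert ha]
    induction n with
    | zero => rw [constCoeff_compl]; simp
    | succ n ih' =>
      rw [coeff_succ_compl_insert lam ha]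
      have h1 := ih (n + 1)
      have h2 : (∑ a ∈ s, lam a) ^ n ≤ (lam a + ∑ a ∈ s, lam a) ^ n :=
        pow_le_pow_left₀ h0 (le_add_of_nonneg_left (hlam a)) n
      rw [pow_succ] at h1 ⊢
      nlinarith [mul_le_mul_of_nonneg_left ih' (hlam a), mul_le_mul_of_nonneg_right h2 h0]

theorem coeff_elem_nonneg (hlam : ∀ a, 0 ≤ lam a) (s : Finset ι) (n : ℕ) :
    0 ≤ (-1) ^ n * coeff n (elem lam s) := by
  classical
  induction s using Finset.induction_on generalizing n with
  | empty => rw [elem, Finset.prod_empty, coeff_one]; split_ifs with h <;> simp [h]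
  | insert a s ha ih =>
    cases n with
    | zero => rw [constCoeff_elem]; simp
    | succ n =>
      rw [coeff_succ_elem_insert lam ha]
      have := add_nonneg (ih (n + 1)) (mul_nonneg (hlam a) (ih n))
      rw [pow_succ] at this ⊢
      linarith

theorem coeff_elem_le (hlam : ∀ a, 0 ≤ lam a) (s : Finset ι) (n : ℕ) :
    (-1) ^ n * coeff n (elem lam s) ≤ (∑ a ∈ s, lam a) ^ n := by
  classical
  induction s using Finset.induction_on generalizing n with
  | empty => rw [elem, Finset.prod_empty, coeff_one]; split_ifs with h <;> simp [h]
  | insert a s ha ih =>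
    have h0 : 0 ≤ ∑ a ∈ s, lam a := Finset.sum_nonneg fun a _ => hlam a
    rw [Finset.sum_insert ha]
    cases n with
    | zero => rw [constCoeff_elem]; simp
    | succ n =>
      rw [coeff_succ_elem_insert lam ha]
      have h1 := ih (n + 1)
      have h3 := ih n
      have h2 : (∑ a ∈ s, lam a) ^ n ≤ (lam a + ∑ a ∈ s, lam a) ^ n :=
        pow_le_pow_left₀ h0 (le_add_of_nonneg_left (hlam a)) n
      rw [pow_succ] at h1 ⊢
      rw [pow_succ] at h1 ⊢
      nlinarith [mul_le_mul_of_nonneg_left (h3.trans h2) (hlam a),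
        mul_le_mul_of_nonneg_right h2 h0]

/-- Up to sign, the Schur polynomial of the hook partition `(N - m, 1 ^ m)`. -/
noncomputable def hook (lam : ι → ℝ) (s : Finset ι) (m N : ℕ) : ℝ :=
  ∑ i ∈ Finset.range (m + 1), coeff i (elem lam s) * coeff (N - i) (compl lam s)

/-- A new variable changes the hook sum by a single product of an elementary and a complete
coefficient, because the sum telescopes (`key`); that product has the sign `(-1)^m`. The condition
`m < N` keeps the constant term of the complete series out, so the empty case vanishes. -/
theorem hook_nonneg (hlam : ∀ a, 0 ≤ lam a) (s : Finset ι) {m N : ℕ} (h : m < N) :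
    0 ≤ (-1) ^ m * hook lam s m N := by
  classical
  induction s using Finset.induction_on generalizing m N with
  | empty =>
    have : hook lam ∅ m N = 0 := by
      refine Finset.sum_eq_zero fun i hi => ?_
      rw [Finset.mem_range] at hi
      rw [compl, Finset.prod_empty, coeff_one, if_neg (by omega), mul_zero]
    simp [this]
  | insert a s ha ih =>
    have key : ∀ m N, m < N → hook lam (insert a s) m N =
        hook lam s m N + lam a * coeff m (elem lam s) *
          coeff (N - (m + 1)) (compl lam (insert a s)) := by
      intro m N h
      induction m with
      | zero =>
        obtain ⟨N, rfl⟩ : ∃ M, N = M + 1 := ⟨N - 1, by omega⟩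
        simp [hook, constCoeff_elem, coeff_succ_compl_insert lam ha]
      | succ m ih =>
        have h1 : ∀ s, hook lam s (m + 1) N = hook lam s m N +
            coeff (m + 1) (elem lam s) * coeff (N - (m + 1)) (compl lam s) := fun s =>
          Finset.sum_range_succ _ _
        obtain ⟨N, rfl⟩ : ∃ M, N = (m + 1) + 1 + M := ⟨N - (m + 2), by omega⟩
        rw [h1, h1, ih (by omega), coeff_succ_elem_insert lam ha,
          show m + 1 + 1 + N - (m + 1) = N + 1 by omega,
          show m + 1 + 1 + N - (m + 1 + 1) = N by omega, coeff_succ_compl_insert lam ha]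
        ring
    rw [key m N h]
    have h2 := coeff_elem_nonneg hlam s m
    have h3 := coeff_compl_nonneg hlam (insert a s) (N - (m + 1))
    have := add_nonneg (ih h) (mul_nonneg (mul_nonneg (hlam a) h2) h3)
    linarith

/-- Consecutive hooks have opposite signs and differ by one product of factors of absolute value at
most one, so each is bounded by that product. -/
theorem abs_hook_le_one (hlam : ∀ a, 0 ≤ lam a) {s : Finset ι} (hs : ∑ a ∈ s, lam a = 1)
    {m N : ℕ} (h : m < N) :
    |hook lam s m N| ≤ 1 := by
  have h0 := hook_nonneg hlam s h
  have h1 : (-1) ^ m * hook lam s m N ≤ 1 := by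
    have hc : ∀ n, coeff n (compl lam s) ≤ 1 := fun n => by
      simpa [hs] using coeff_compl_le hlam s n
    have he : ∀ n, (-1) ^ n * coeff n (elem lam s) ≤ 1 := fun n => by
      simpa [hs] using coeff_elem_le hlam s n
    cases m with
    | zero => simpa [hook, constCoeff_elem] using hc N
    | succ m =>
      have h2 := hook_nonneg hlam s (show m < N by omega)
      have h3 : hook lam s (m + 1) N = hook lam s m N +
            coeff (m + 1) (elem lam s) * coeff (N - (m + 1)) (compl lam s) :=
        Finset.sum_range_succ _ _
      have h4 := mul_le_one₀ (he (m + 1)) (coeff_compl_nonneg hlam s (N - (m + 1)))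
        (hc (N - (m + 1)))
      rw [h3]
      rw [pow_succ] at h4 ⊢
      linarith
  rw [← abs_of_nonneg h0, abs_mul, abs_pow, abs_neg, abs_one, one_pow, one_mul] at h1
  exact h1

end Bounds

end SymmSeries

/-! ## Stability of the Newton-Girard continuation -/

namespace SymmSeries

open PowerSeries

/-- The signed series of the Newton-Girard coefficients up to index `r`. -/
noncomputable def girard (r : ℕ) (Q : ℕ → ℝ) : PowerSeries ℝ :=
  PowerSeries.mk fun m => if m ≤ r then (-1) ^ m * newtonGirard Q m else 0

/-- The series of the extended power sums. -/
noncomputable def extended (r : ℕ) (Q : ℕ → ℝ) : PowerSeries ℝ :=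
  PowerSeries.mk fun n => if n = 0 then 0 else extendPowerSums r Q n

theorem extendPowerSums_of_le {r n : ℕ} (h : n ≤ r) (Q : ℕ → ℝ) :
    extendPowerSums r Q n = Q n := by
  rw [extendPowerSums, if_pos h]

theorem newtonGirard_zero (Q : ℕ → ℝ) : newtonGirard Q 0 = 1 := by
  rw [newtonGirard]

theorem coeff_X_mul_derivative (f : PowerSeries ℝ) (n : ℕ) :
    coeff n (X * derivative ℝ f) = n * coeff n f := by
  cases n with
  | zero => simp
  | succ n =>
    rw [coeff_succ_X_mul, coeff_derivative]
    push_cast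
    ring

theorem neg_one_pow_succ_mul {l n : ℕ} (h : l ≤ n) :
    (-1 : ℝ) ^ (n + 1) * (-1) ^ l = -(-1) ^ (n - l) := by
  obtain ⟨m, rfl⟩ := Nat.exists_eq_add_of_le h
  have h1 : (-1 : ℝ) ^ l * (-1) ^ l = 1 := by rw [← mul_pow]; simp
  rw [Nat.add_sub_cancel_left, pow_succ, pow_add]
  linear_combination (-(-1 : ℝ) ^ m) * h1

/-- In degrees up to `r` this is the definition of the `b_m`. Above `r` the left side vanishes by
truncation, and the right side vanishes by the recurrence that continues the power sums. -/
theorem X_mul_derivative_girard (r : ℕ) (Q : ℕ → ℝ) :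
    X * derivative ℝ (girard r Q) = -(girard r Q * extended r Q) := by
  ext n
  rw [coeff_X_mul_derivative, map_neg, coeff_mul]
  cases n with
  | zero => simp [extended]
  | succ n =>
    by_cases h : n + 1 ≤ r
    · rw [← Finset.Nat.sum_antidiagonal_swap]
      simp only [Prod.fst_swap, Prod.snd_swap]
      rw [Finset.Nat.sum_antidiagonal_eq_sum_range_succ
        (fun i j => coeff j (girard r Q) * coeff i (extended r Q)), Finset.sum_range_succ']
      simp only [girard, extended, coeff_mk, if_pos h]
      rw [newtonGirard, if_pos trivial, mul_zero, add_zero, Finset.sum_range, Finset.mul_sum,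
        Finset.mul_sum, Finset.mul_sum, ← Finset.sum_neg_distrib]
      refine Finset.sum_congr rfl fun l _ => ?_
      have hl := l.2
      rw [if_pos (by omega), if_neg (by omega), extendPowerSums_of_le (by omega),
        show n + 1 - (l + 1) = n - l by omega]
      have h1 : ((n : ℝ) + 1) ≠ 0 := by positivity
      have h2 := neg_one_pow_succ_mul (l := l) (n := n) (by omega)
      push_cast
      field_simp
      linear_combination (newtonGirard Q (n - l) * Q (l + 1)) * h2
    · rw [Finset.Nat.sum_antidiagonal_eq_sum_range_succ
        (fun i j => coeff i (girard r Q) * coeff j (extended r Q))]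
      have h1 : ∀ m, r < m → coeff m (girard r Q) = 0 := fun m hm => by
        rw [girard, coeff_mk, if_neg (by omega)]
      rw [h1 _ (by omega), mul_zero, ← Finset.sum_subset
        (Finset.range_subset_range.mpr (show r + 1 ≤ (n + 1).succ by omega)), Finset.sum_range_succ']
      · simp only [girard, extended, coeff_mk]
        -- Since `b_0 = 1`, the term of index `0` is the newest power sum itself; expanding it by
        -- the recurrence cancels all the others.
        rw [if_pos (by omega), newtonGirard_zero, if_neg (by omega), Nat.sub_zero, pow_zero,
          extendPowerSums, if_neg h, Finset.sum_range]
        rw [mul_one, one_mul, neg_add, ← Finset.sum_neg_distrib, ← Finset.sum_neg_distrib,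
          ← Finset.sum_add_distrib]
        symm
        refine Finset.sum_eq_zero fun l _ => ?_
        have hl := l.2
        rw [if_pos (by omega), if_neg (by omega), pow_succ]
        ring
      · intro m _ hm
        rw [Finset.mem_range, not_lt] at hm
        rw [h1 _ (by omega), zero_mul]

/-! ### The quotient series that encodes the errors -/

section Quotient

variable {ι : Type*} (lam : ι → ℝ) (s : Finset ι) (r : ℕ) (Q : ℕ → ℝ)

/-- The quotient of the Newton-Girard series by the series of the exact elementary symmetric
polynomials. -/
noncomputable def quot : PowerSeries ℝ := girard r Q * compl lam s

theorem elem_mul_quot : elem lam s * quot lam s r Q = girard r Q := by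
  rw [quot]
  linear_combination girard r Q * elem_mul_compl lam s

theorem coeff_zero_quot : coeff 0 (quot lam s r Q) = 1 := by
  rw [quot, coeff_mul]
  simp [constCoeff_compl lam s, girard, newtonGirard_zero, - coeff_zero_eq_constantCoeff]

/-- The logarithmic derivative of a quotient is a difference of logarithmic derivatives; here it is
minus the series of the errors. -/
theorem X_mul_derivative_quot :
    X * derivative ℝ (quot lam s r Q) =
      -(quot lam s r Q * (extended r Q - psum lam s)) := by
  have h1 := X_mul_derivative_girard r Q
  have h2 := X_mul_derivative_elem lam s
  have h3 := elem_mul_compl lam s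
  have h4 := elem_mul_quot lam s r Q
  rw [← h4, Derivation.leibniz] at h1
  simp only [smul_eq_mul] at h1
  linear_combination compl lam s * h1 - compl lam s * quot lam s r Q * h2 -
    (X * derivative ℝ (quot lam s r Q) +
      (quot lam s r Q * (extended r Q - psum lam s))) * h3

theorem nat_mul_coeff_quot (n : ℕ) :
    (n : ℝ) * coeff n (quot lam s r Q) = -∑ i ∈ Finset.range n,
      coeff i (quot lam s r Q) * (extendPowerSums r Q (n - i) - ∑ a ∈ s, lam a ^ (n - i)) := by
  rw [← coeff_X_mul_derivative, X_mul_derivative_quot, map_neg, coeff_mul,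
    Finset.Nat.sum_antidiagonal_eq_sum_range_succ
      (fun i j => coeff i (quot lam s r Q) * coeff j (extended r Q - psum lam s)),
    Finset.sum_range_succ]
  rw [Nat.sub_self]
  have h0 : coeff 0 (extended r Q - psum lam s) = 0 := by
    rw [map_sub, extended, psum, coeff_mk, coeff_mk]
    simp
  rw [h0, mul_zero, add_zero]
  congr 1
  refine Finset.sum_congr rfl fun i hi => ?_
  rw [Finset.mem_range] at hi
  rw [map_sub, extended, psum, coeff_mk, coeff_mk, if_neg (by omega), if_neg (by omega)]

variable {s r} in
-- As `G` has degree at most `r`, `U_n = ∑_{m ≤ r} G_m h_{n-m}`. Inserting `G_m = ∑_j U_j E_{m-j}`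
-- and collecting by `j` leaves truncated convolutions of `E` and `H`, the hooks. For `j = 0`
-- nothing is truncated, since `E` has degree at most `r`, and the convolution is a coefficient of
-- `E H = 1`. So `U_0 = 1` drops out and only small terms remain.
theorem coeff_quot_of_lt (hs : s.card ≤ r) {n : ℕ} (hn : r < n) :
    coeff n (quot lam s r Q) = ∑ j ∈ Finset.Icc 1 r,
      coeff j (quot lam s r Q) * hook lam s (r - j) (n - j) := by
  have h1 : ∀ m ≤ r, coeff m (girard r Q) = ∑ j ∈ Finset.range (m + 1),
      coeff j (quot lam s r Q) * coeff (m - j) (elem lam s) := fun m _ => by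
    rw [← elem_mul_quot lam s r Q, mul_comm, coeff_mul,
      Finset.Nat.sum_antidiagonal_eq_sum_range_succ
      (fun i j => coeff i (quot lam s r Q) * coeff j (elem lam s))]
  have h2 : coeff n (quot lam s r Q) = ∑ m ∈ Finset.range (r + 1),
      coeff m (girard r Q) * coeff (n - m) (compl lam s) := by
    rw [quot, coeff_mul, Finset.Nat.sum_antidiagonal_eq_sum_range_succ
      (fun i j => coeff i (girard r Q) * coeff j (compl lam s))]
    symm
    refine Finset.sum_subset (Finset.range_subset_range.mpr (by omega)) fun m _ hm => ?_
    rw [Finset.mem_range, not_lt] at hm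
    rw [girard, coeff_mk, if_neg (by omega), zero_mul]
  have h3 : hook lam s r n = 0 := by
    have h := congrArg (coeff n) (elem_mul_compl lam s)
    rw [coeff_one, if_neg (by omega), coeff_mul, Finset.Nat.sum_antidiagonal_eq_sum_range_succ
      (fun i j => coeff i (elem lam s) * coeff j (compl lam s))] at h
    rw [hook, ← h]
    refine Finset.sum_subset (Finset.range_subset_range.mpr (by omega)) fun m _ hm => ?_
    rw [Finset.mem_range, not_lt] at hm
    rw [coeff_elem_of_card_lt lam s m (by omega), zero_mul]
  have h4 : coeff n (quot lam s r Q) = ∑ j ∈ Finset.range (r + 1),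
      coeff j (quot lam s r Q) * hook lam s (r - j) (n - j) := by
    rw [h2]
    have h5 : ∀ m ∈ Finset.range (r + 1), coeff m (girard r Q) * coeff (n - m) (compl lam s) =
        ∑ j ∈ Finset.range (m + 1), coeff j (quot lam s r Q) * coeff (m - j) (elem lam s) *
          coeff (n - m) (compl lam s) := fun m hm => by
      rw [Finset.mem_range] at hm
      rw [h1 m (by omega), Finset.sum_mul]
    have h6 : ∀ j ∈ Finset.range (r + 1), coeff j (quot lam s r Q) * hook lam s (r - j) (n - j) =
        ∑ i ∈ Finset.range (r - j + 1), coeff j (quot lam s r Q) *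
          (coeff i (elem lam s) * coeff (n - j - i) (compl lam s)) := fun j _ => by
      rw [hook, Finset.mul_sum]
    rw [Finset.sum_congr rfl h5, Finset.sum_sigma', Finset.sum_congr rfl h6, Finset.sum_sigma']
    -- The triangle `j ≤ m ≤ r` in the coordinates `j` and `i = m - j`.
    refine Finset.sum_bij' (fun x _ => ⟨x.2, x.1 - x.2⟩) (fun y _ => ⟨y.1 + y.2, y.1⟩) ?_ ?_ ?_ ?_ ?_
    · rintro ⟨m, j⟩ h
      simp only [Finset.mem_sigma, Finset.mem_range] at h ⊢
      omega
    · rintro ⟨j, i⟩ h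
      simp only [Finset.mem_sigma, Finset.mem_range] at h ⊢
      omega
    · rintro ⟨m, j⟩ h
      simp only [Finset.mem_sigma, Finset.mem_range] at h
      simp only [Sigma.mk.injEq, heq_eq_eq, and_true]
      omega
    · rintro ⟨j, i⟩ h
      simp
    · rintro ⟨m, j⟩ h
      simp only [Finset.mem_sigma, Finset.mem_range] at h
      simp only
      rw [show n - j - (m - j) = n - m by omega]
      ring
  rw [h4, Finset.sum_range_eq_add_Ico _ (by omega : 0 < r + 1), Nat.sub_zero, Nat.sub_zero, h3,
    mul_zero, zero_add]
  rfl

end Quotient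

end SymmSeries

namespace SymmSeries

/-! ### Bounds for the recurrence `n U_n = -∑ U_i f_{n-i}` -/

section Recurrence

variable {U f : ℕ → ℝ}

/-- A discrete Gronwall argument: `(n + 1) |U_{n+1}| ≤ η ∑_{i ≤ n} |U_i|`, so the partial sum grows
at most by the factor `1 + η / (n + 1)`. -/
theorem sum_abs_le_prod {η : ℝ} {r : ℕ} (hU : U 0 = 1)
    (h : ∀ n : ℕ, n * U n = -∑ i ∈ Finset.range n, U i * f (n - i))
    (hf : ∀ i, 1 ≤ i → i ≤ r → |f i| ≤ η) :
    ∀ n ≤ r, ∑ i ∈ Finset.range (n + 1), |U i| ≤ ∏ i ∈ Finset.range n, (1 + η / (i + 1)) := by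
  intro n
  induction n with
  | zero => simp [hU]
  | succ n ih =>
    intro hn
    have hη : 0 ≤ η := (abs_nonneg _).trans (hf 1 le_rfl (by omega))
    have h1 : ((n : ℝ) + 1) * |U (n + 1)| ≤ η * ∑ i ∈ Finset.range (n + 1), |U i| := by
      rw [← abs_of_nonneg (by positivity : (0 : ℝ) ≤ (n : ℝ) + 1), ← abs_mul]
      have := h (n + 1)
      push_cast at this
      rw [this, abs_neg, Finset.mul_sum]
      refine (Finset.abs_sum_le_sum_abs _ _).trans (Finset.sum_le_sum fun i hi => ?_)
      rw [Finset.mem_range] at hi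
      rw [abs_mul, mul_comm]
      exact mul_le_mul_of_nonneg_right (hf _ (by omega) (by omega)) (abs_nonneg _)
    rw [Finset.sum_range_succ, Finset.prod_range_succ]
    have h2 : |U (n + 1)| ≤ η / (n + 1) * ∑ i ∈ Finset.range (n + 1), |U i| := by
      rw [div_mul_eq_mul_div, le_div_iff₀ (by positivity)]
      linarith
    have h3 := mul_le_mul_of_nonneg_right (ih (by omega)) (by positivity : 0 ≤ 1 + η / ((n : ℝ) + 1))
    linarith

/-- As `U_0 = 1`, the recurrence can be solved for its newest error. -/
theorem abs_succ_le_of_recurrence (hU : U 0 = 1)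
    (h : ∀ n : ℕ, n * U n = -∑ i ∈ Finset.range n, U i * f (n - i)) (n : ℕ) :
    |f (n + 1)| ≤ (n + 1) * |U (n + 1)| + ∑ i ∈ Finset.range n, |U (n - i)| * |f (i + 1)| := by
  have h1 := h (n + 1)
  rw [Finset.sum_range_succ', hU, one_mul, Nat.sub_zero, ← Finset.sum_range_reflect] at h1
  have h2 : f (n + 1) = -((n + 1 : ℕ) * U (n + 1)) -
      ∑ i ∈ Finset.range n, U (n - i) * f (i + 1) := by
    rw [h1]
    have : ∀ i ∈ Finset.range n, U (n - 1 - i + 1) * f (n + 1 - (n - 1 - i + 1)) =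
        U (n - i) * f (i + 1) := fun i hi => by
      rw [Finset.mem_range] at hi
      rw [show n - 1 - i + 1 = n - i by omega, show n + 1 - (n - i) = i + 1 by omega]
    rw [Finset.sum_congr rfl this]
    ring
  rw [h2]
  refine (abs_sub _ _).trans (add_le_add ?_ ?_)
  · rw [abs_neg, abs_mul, abs_of_nonneg (by positivity)]
    push_cast
    exact le_rfl
  · refine (Finset.abs_sum_le_sum_abs _ _).trans (le_of_eq ?_)
    simp [abs_mul]

/-- The induction closes exactly: `(n + 1) S + S ∑_{i=1}^n ((1 + S)^i - 1) = S ∑_{i=0}^n (1 + S)^i =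
(1 + S)^(n+1) - 1`. -/
theorem abs_le_pow_sub_one {S : ℝ} (hU : U 0 = 1)
    (h : ∀ n : ℕ, n * U n = -∑ i ∈ Finset.range n, U i * f (n - i))
    (hS : ∀ n, 1 ≤ n → |U n| ≤ S) (n : ℕ) (hn : 1 ≤ n) : |f n| ≤ (1 + S) ^ n - 1 := by
  have hS0 : 0 ≤ S := (abs_nonneg _).trans (hS 1 le_rfl)
  induction n using Nat.strong_induction_on with
  | _ n ih =>
    obtain ⟨n, rfl⟩ : ∃ m, n = m + 1 := ⟨n - 1, by omega⟩
    refine (abs_succ_le_of_recurrence hU h n).trans ?_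
    have h1 : ∑ i ∈ Finset.range n, |U (n - i)| * |f (i + 1)| ≤
        ∑ i ∈ Finset.range n, S * ((1 + S) ^ (i + 1) - 1) := by
      refine Finset.sum_le_sum fun i hi => ?_
      rw [Finset.mem_range] at hi
      exact mul_le_mul (hS _ (by omega)) (ih _ (by omega) (by omega)) (abs_nonneg _) hS0
    have h2 := mul_le_mul_of_nonneg_left (hS (n + 1) (by omega))
      (by positivity : (0 : ℝ) ≤ (n : ℝ) + 1)
    have h3 := geom_sum_mul (1 + S) (n + 1)
    rw [Finset.sum_range_succ'] at h3
    rw [← Finset.mul_sum, Finset.sum_sub_distrib] at h1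
    simp only [Finset.sum_const, Finset.card_range, nsmul_eq_mul, mul_one] at h1
    linarith

/-- A sharper bound if the first coefficient is larger than the other ones. -/
theorem abs_le_pow_sub_one_of_two_le {S η a : ℝ} (hU : U 0 = 1)
    (h : ∀ n : ℕ, n * U n = -∑ i ∈ Finset.range n, U i * f (n - i))
    (ha : 0 < a)
    (hf1 : |f 1| ≤ η) (hf2 : |f 2| ≤ (1 + a) ^ 2 - 1)
    (hU1 : |U 1| ≤ η) (hS : ∀ n, 2 ≤ n → |U n| ≤ S)
    (hSa : S * (1 + η - a) ≤ a) (hSa' : S / a + η ≤ 1 + a) (n : ℕ) (hn : 2 ≤ n) :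
    |f n| ≤ (1 + a) ^ n - 1 := by
  have hS0 : 0 ≤ S := (abs_nonneg _).trans (hS 2 le_rfl)
  have hη : 0 ≤ η := (abs_nonneg _).trans hf1
  induction n using Nat.strong_induction_on with
  | _ n ih =>
    rcases Nat.lt_or_ge n 3 with h3 | h3
    · rwa [show n = 2 by omega]
    obtain ⟨n, rfl⟩ : ∃ m, n = m + 3 := ⟨n - 3, by omega⟩
    refine (abs_succ_le_of_recurrence hU h (n + 2)).trans ?_
    rw [Finset.sum_range_succ, Finset.sum_range_succ', show n + 2 - (n + 1) = 1 by omega]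
    have h1 : ∑ i ∈ Finset.range n, |U (n + 2 - (i + 1))| * |f (i + 1 + 1)| ≤
        ∑ i ∈ Finset.range n, S * ((1 + a) ^ (i + 1 + 1) - 1) := by
      refine Finset.sum_le_sum fun i hi => ?_
      rw [Finset.mem_range] at hi
      exact mul_le_mul (hS _ (by omega)) (ih _ (by omega) (by omega)) (abs_nonneg _) hS0
    have h2 := mul_le_mul_of_nonneg_left (hS (n + 3) (by omega))
      (by positivity : (0 : ℝ) ≤ (n : ℝ) + 3)
    have h4 : |U (n + 2 - 0)| * |f (0 + 1)| ≤ S * η :=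
      mul_le_mul (hS _ (by omega)) hf1 (abs_nonneg _) hS0
    have h5 : |U 1| * |f (n + 1 + 1)| ≤ η * ((1 + a) ^ (n + 1 + 1) - 1) :=
      mul_le_mul hU1 (ih _ (by omega) (by omega)) (abs_nonneg _) hη
    have h6 : ∑ i ∈ Finset.range n, (1 + a) ^ (i + 1 + 1) = ((1 + a) ^ (n + 2) - 1) / a - (2 + a) := by
      have h7 := geom_sum_mul (1 + a) (n + 2)
      rw [Finset.sum_range_succ', Finset.sum_range_succ'] at h7
      rw [eq_sub_iff_add_eq, eq_div_iff ha.ne']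
      linear_combination h7
    rw [← Finset.mul_sum, Finset.sum_sub_distrib, h6] at h1
    simp only [Finset.sum_const, Finset.card_range, nsmul_eq_mul, mul_one] at h1
    have h8 : 0 ≤ (1 + a) ^ (n + 2) - 1 := by
      rw [sub_nonneg]
      exact one_le_pow₀ (by linarith)
    -- The total is at most `S (1 + η - a) + (S / a + η) ((1 + a)^(n+2) - 1)`. The hypotheses `hSa`
    -- and `hSa'` bound the two summands by those of `a + (1 + a) ((1 + a)^(n+2) - 1) = (1 +
    -- a)^(n+3) - 1`.
    have h9 := mul_le_mul_of_nonneg_right hSa' h8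
    have h10 : S * (((1 + a) ^ (n + 2) - 1) / a) = S / a * ((1 + a) ^ (n + 2) - 1) := by ring
    rw [show n + 2 + 1 = n + 3 by omega]
    rw [show n + 1 + 1 = n + 2 by omega] at h5 ⊢
    rw [Nat.cast_add, Nat.cast_ofNat]
    have h11 : (1 + a) ^ (n + 3) = (1 + a) * (1 + a) ^ (n + 2) := by ring
    rw [h11]
    have h12 : (1 + a) * (1 + a) ^ (n + 2) - 1 = (1 + a) * ((1 + a) ^ (n + 2) - 1) + a := by ring
    rw [h12]
    have h13 : S * (((1 + a) ^ (n + 2) - 1) / a - (2 + a) - n) =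
        S * (((1 + a) ^ (n + 2) - 1) / a) - S * (2 + a) - S * n := by ring
    rw [h13, h10] at h1
    linarith

end Recurrence

/-- By convexity `2^ε` lies below its chord `1 + ε` on `[0, 1]`. -/
theorem exp_sub_one_lt {x ε : ℝ} (hε : 0 < ε) (hε1 : ε ≤ 1) (hx : x < ε * Real.log 2) :
    Real.exp x - 1 < ε := by
  have h1 : Real.exp x < Real.exp (ε * Real.log 2) := Real.exp_lt_exp.mpr hx
  have h2 : Real.exp (ε * Real.log 2) ≤ 1 + ε := by
    rw [mul_comm, ← Real.rpow_def_of_pos (by norm_num)]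
    have := rpow_one_add_le_one_add_mul_self (s := 1) (by norm_num) hε.le hε1
    norm_num at this ⊢
    exact this
  linarith

/-- With `1 + x ≤ exp x` the exponent becomes a harmonic number; this is the origin of the logarithm
in the accuracy. -/
theorem prod_one_add_div_le {η : ℝ} (hη : 0 ≤ η) (r : ℕ) :
    ∏ i ∈ Finset.range r, (1 + η / ((i : ℝ) + 1)) ≤ Real.exp (η * (1 + Real.log r)) := by
  have h1 : ∏ i ∈ Finset.range r, (1 + η / ((i : ℝ) + 1)) ≤
      ∏ i ∈ Finset.range r, Real.exp (η / ((i : ℝ) + 1)) := by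
    refine Finset.prod_le_prod (fun i _ => by positivity) fun i _ => ?_
    rw [add_comm]
    exact Real.add_one_le_exp _
  refine h1.trans ?_
  rw [← Real.exp_sum, Real.exp_le_exp]
  have h2 := harmonic_le_one_add_log r
  have h3 : ∑ i ∈ Finset.range r, η / ((i : ℝ) + 1) = η * harmonic r := by
    rw [harmonic]
    push_cast
    rw [Finset.mul_sum]
    rfl
  rw [h3]
  exact mul_le_mul_of_nonneg_left h2 hη

section Stability

variable {ι : Type*} {lam : ι → ℝ} {s : Finset ι} {r : ℕ} {Q : ℕ → ℝ}

open PowerSeries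

theorem recurrence_quot (n : ℕ) :
    (n : ℝ) * coeff n (quot lam s r Q) = -∑ i ∈ Finset.range n,
      coeff i (quot lam s r Q) *
        (fun m => extendPowerSums r Q m - ∑ a ∈ s, lam a ^ m) (n - i) :=
  nat_mul_coeff_quot lam s r Q n

/-- If the first `r` power sums are known up to `η`, where `k η (1 + log r) < ε log 2`, then the
continued power sums up to index `k` are correct up to `ε`. -/
theorem abs_extendPowerSums_sub_lt (hlam : ∀ a, 0 ≤ lam a) (hs : ∑ a ∈ s, lam a = 1)
    (hcard : s.card ≤ r) {η ε : ℝ} (hη : 0 ≤ η) (hε : 0 < ε) (hε1 : ε ≤ 1) {k : ℕ}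
    (hk : k * (η * (1 + Real.log r)) < ε * Real.log 2)
    (hQ : ∀ j, 1 ≤ j → j ≤ r → |Q j - ∑ a ∈ s, lam a ^ j| ≤ η) {i : ℕ} (hi : 1 ≤ i) (hik : i ≤ k) :
    |extendPowerSums r Q i - ∑ a ∈ s, lam a ^ i| < ε := by
  have hf : ∀ j, 1 ≤ j → j ≤ r → |extendPowerSums r Q j - ∑ a ∈ s, lam a ^ j| ≤ η :=
    fun j h1 h2 => by rw [extendPowerSums_of_le h2]; exact hQ j h1 h2
  have hU := coeff_zero_quot lam s r Q
  have hsum := sum_abs_le_prod (U := fun n => coeff n (quot lam s r Q)) hU recurrence_quot hf r le_rfl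
  set S := ∏ i ∈ Finset.range r, (1 + η / ((i : ℝ) + 1)) - 1 with hSdef
  have hIcc : ∑ j ∈ Finset.Icc 1 r, |coeff j (quot lam s r Q)| ≤ S := by
    rw [Finset.sum_range_eq_add_Ico _ (by omega : 0 < r + 1), hU, abs_one] at hsum
    have : Finset.Ico 1 (r + 1) = Finset.Icc 1 r := rfl
    rw [this] at hsum
    linarith
  have hS : ∀ n, 1 ≤ n → |coeff n (quot lam s r Q)| ≤ S := by
    intro n hn
    refine le_trans ?_ hIcc
    by_cases hnr : n ≤ r
    · exact Finset.single_le_sum (f := fun j => |coeff j (quot lam s r Q)|)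
        (fun _ _ => abs_nonneg _) (Finset.mem_Icc.mpr ⟨hn, hnr⟩)
    -- Hooks are at most one in absolute value, so coefficients beyond `r` do not exceed the sum of
    -- the earlier ones.
    · rw [coeff_quot_of_lt lam Q hcard (by omega)]
      refine (Finset.abs_sum_le_sum_abs _ _).trans (Finset.sum_le_sum fun j hj => ?_)
      rw [Finset.mem_Icc] at hj
      rw [abs_mul]
      exact mul_le_of_le_one_right (abs_nonneg _) (abs_hook_le_one hlam hs (by omega))
  refine (abs_le_pow_sub_one (U := fun n => coeff n (quot lam s r Q))
    (f := fun m => extendPowerSums r Q m - ∑ a ∈ s, lam a ^ m) hU recurrence_quot hS i hi).trans_lt ?_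
  refine lt_of_le_of_lt ?_ (exp_sub_one_lt hε hε1 hk)
  have h0 : 0 ≤ S := (abs_nonneg _).trans (hS 1 le_rfl)
  have h1 : 1 + S ≤ Real.exp (η * (1 + Real.log r)) := by
    rw [hSdef, add_sub_cancel]
    exact prod_one_add_div_le hη r
  rw [Real.exp_nat_mul]
  have h2 : (1 + S) ^ i ≤ (1 + S) ^ k := pow_le_pow_right₀ (by linarith) hik
  have h3 := pow_le_pow_left₀ (by linarith) h1 k
  linarith

/-- The case of rank two with the accuracy `ε / (2 k log 2)`. -/
theorem abs_extendPowerSums_two_sub_lt (hlam : ∀ a, 0 ≤ lam a) (hs : ∑ a ∈ s, lam a = 1)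
    (hcard : s.card ≤ 2) {ε : ℝ} (hε : 0 < ε) (hε1 : ε ≤ 1) {k : ℕ}
    (hQ : ∀ j, 1 ≤ j → j ≤ 2 → |Q j - ∑ a ∈ s, lam a ^ j| ≤ ε / (k * 2 * Real.log 2)) {i : ℕ}
    (hi : 3 ≤ i) (hik : i ≤ k) :
    |extendPowerSums 2 Q i - ∑ a ∈ s, lam a ^ i| < ε := by
  have hl := Real.log_two_gt_d9
  set η := ε / (k * 2 * Real.log 2) with hηdef
  have hk3 : (3 : ℝ) ≤ k := by exact_mod_cast hi.trans hik
  have hη0 : 0 < η := by positivity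
  have hkη : k * (2 * Real.log 2) * η = ε := by
    rw [hηdef]
    field_simp
  -- From `k ≥ 3`, `ε ≤ 1` and `6 log 2 > 4.158`. The numerical inequalities below need `η` this
  -- small.
  have hη : η ≤ 0.2405 := by
    have : 4.158 ≤ k * (2 * Real.log 2) := by nlinarith
    nlinarith
  have hf : ∀ j, 1 ≤ j → j ≤ 2 → |extendPowerSums 2 Q j - ∑ a ∈ s, lam a ^ j| ≤ η :=
    fun j h1 h2 => by rw [extendPowerSums_of_le h2]; exact hQ j h1 h2
  have hU := coeff_zero_quot lam s 2 Q
  have hrec := recurrence_quot (lam := lam) (s := s) (r := 2) (Q := Q)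
  have hU1 : |coeff 1 (quot lam s 2 Q)| ≤ η := by
    have h := hrec 1
    simp only [Nat.cast_one, one_mul, Finset.range_one, Finset.sum_singleton, hU] at h
    rw [h, abs_neg]
    exact hf 1 le_rfl (by norm_num)
  have hU2 : |coeff 2 (quot lam s 2 Q)| ≤ η * (1 + η) / 2 := by
    have h := hrec 2
    simp only [Finset.sum_range_succ, Finset.range_one, Finset.sum_singleton, hU, one_mul] at h
    have h2 : |(2 : ℝ) * coeff 2 (quot lam s 2 Q)| ≤ η + η * η := by
      push_cast at h
      rw [h, abs_neg]
      refine (abs_add_le _ _).trans (add_le_add (hf 2 (by norm_num) le_rfl) ?_)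
      rw [abs_mul]
      exact mul_le_mul hU1 (hf 1 le_rfl (by norm_num)) (abs_nonneg _) hη0.le
    rw [abs_mul, abs_two] at h2
    linarith
  have hc : ∀ n, coeff n (compl lam s) ≤ 1 := fun n => by
    simpa [hs] using coeff_compl_le hlam s n
  have hprod : ∀ n, coeff (n + 2) (compl lam s) + coeff 1 (elem lam s) * coeff (n + 1) (compl lam s)
      = - (coeff 2 (elem lam s) * coeff n (compl lam s)) := fun n => by
    have h := congrArg (coeff (n + 2)) (elem_mul_compl lam s)
    rw [coeff_one, if_neg (by omega), coeff_mul, Finset.Nat.sum_antidiagonal_eq_sum_range_succ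
      (fun i j => coeff i (elem lam s) * coeff j (compl lam s)), ← Finset.sum_subset
      (Finset.range_subset_range.mpr (by omega : 3 ≤ (n + 2).succ))] at h
    · simp only [Finset.sum_range_succ, Finset.range_one, Finset.sum_singleton, constCoeff_elem] at h
      simp only [Nat.add_sub_cancel, Nat.sub_zero, one_mul,
        show n + 2 - 1 = n + 1 by omega] at h
      linarith
    · intro m _ hm
      rw [Finset.mem_range, not_lt] at hm
      rw [coeff_elem_of_card_lt lam s m (by omega), zero_mul]
  -- Newton's identity gives `e_2 = (1 - p_2) / 2`, and `p_2 ≥ 1/2` by Cauchy-Schwarz for at most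
  -- two eigenvalues.
  have he2 : |coeff 2 (elem lam s)| ≤ 1 / 4 := by
    have h0 := coeff_elem_nonneg hlam s 2
    have hd := X_mul_derivative_elem lam s
    have hd1 := congrArg (coeff 1) hd
    have hd2 := congrArg (coeff 2) hd
    rw [coeff_X_mul_derivative, map_neg, coeff_mul,
      Finset.Nat.sum_antidiagonal_eq_sum_range_succ
      (fun i j => coeff i (elem lam s) * coeff j (psum lam s))] at hd1 hd2
    simp only [Finset.sum_range_succ, Finset.range_zero, Finset.sum_empty, constCoeff_elem, psum, coeff_mk] at hd1 hd2
    simp [hs] at hd1 hd2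
    have hcs : (1 : ℝ) ≤ 2 * ∑ a ∈ s, lam a ^ 2 := by
      have h := sq_sum_le_card_mul_sum_sq (s := s) (f := lam)
      rw [hs, one_pow] at h
      refine h.trans (mul_le_mul_of_nonneg_right (by exact_mod_cast hcard)
        (Finset.sum_nonneg fun a _ => sq_nonneg _))
    rw [abs_of_nonneg (by simpa using h0)]
    rw [hd1] at hd2
    linarith
  -- For `n ≥ 3` the hook multiplying `U_1` is `-e_2 h_{n-3}`, at most `1/4` in absolute value, and
  -- the one multiplying `U_2` is at most `1`; `η / 4 + η (1 + η) / 2` is the bound.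
  have hS : ∀ n, 2 ≤ n → |coeff n (quot lam s 2 Q)| ≤ η * (3 / 4 + η / 2) := by
    intro n hn
    rcases Nat.lt_or_ge n 3 with h3 | h3
    · rw [show n = 2 by omega]
      nlinarith
    obtain ⟨n, rfl⟩ : ∃ m, n = m + 3 := ⟨n - 3, by omega⟩
    rw [coeff_quot_of_lt lam Q hcard (by omega)]
    have : Finset.Icc 1 2 = {1, 2} := rfl
    rw [this, Finset.sum_pair (by norm_num)]
    have h1 : |hook lam s (2 - 1) (n + 3 - 1)| ≤ 1 / 4 := by
      have : hook lam s (2 - 1) (n + 3 - 1) = -(coeff 2 (elem lam s) * coeff n (compl lam s)) := by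
        rw [← hprod n, hook, show n + 3 - 1 = n + 2 by omega]
        simp only [Finset.sum_range_succ, Finset.range_zero, Finset.sum_empty, constCoeff_elem]
        simp
      rw [this, abs_neg, abs_mul, abs_of_nonneg (coeff_compl_nonneg hlam s n)]
      have := mul_le_mul he2 (hc n) (coeff_compl_nonneg hlam s n) (by norm_num)
      linarith
    have h2 : |hook lam s (2 - 2) (n + 3 - 2)| ≤ 1 := abs_hook_le_one hlam hs (by omega)
    refine (abs_add_le _ _).trans ?_
    rw [abs_mul, abs_mul]
    have h4 := mul_le_mul hU1 h1 (abs_nonneg _) hη0.le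
    have h5 := mul_le_mul hU2 h2 (abs_nonneg _) (by positivity)
    linarith
  -- The rate `a = 0.9 η` has to exceed `S`, roughly `3 η / 4`, for the induction, and to stay below
  -- `2 (log 2)^2 η`, roughly `0.96 η`, for the final comparison with `2^ε`.
  have hSa : η * (3 / 4 + η / 2) * (1 + η - 0.9 * η) ≤ 0.9 * η := by
    have h1 : (3 / 4 + η / 2) * (1 + 0.1 * η) ≤ 0.9 := by nlinarith
    linarith [mul_le_mul_of_nonneg_left h1 hη0.le]
  have hfi := abs_le_pow_sub_one_of_two_le (U := fun n => coeff n (quot lam s 2 Q))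
    (f := fun m => extendPowerSums 2 Q m - ∑ a ∈ s, lam a ^ m) (S := η * (3 / 4 + η / 2))
    (η := η) (a := 0.9 * η) hU hrec (by positivity) (hf 1 le_rfl (by norm_num))
    ((hf 2 (by norm_num) le_rfl).trans (by nlinarith)) hU1 hS hSa
    (by
      rw [mul_comm η, mul_div_mul_right _ _ hη0.ne', div_add' _ _ _ (by norm_num),
        div_le_iff₀ (by norm_num)]
      linarith) i (by omega)
  refine hfi.trans_lt ?_
  have hx : (k : ℝ) * (0.9 * η) < ε * Real.log 2 := by
    rw [← hkη]
    have h1 : 0 < (k : ℝ) * η := by positivity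
    have h2 : 0.9 < 2 * Real.log 2 * Real.log 2 := by nlinarith
    nlinarith
  refine lt_of_le_of_lt ?_ (exp_sub_one_lt hε hε1 hx)
  rw [Real.exp_nat_mul]
  have h2 : (1 + 0.9 * η) ^ i ≤ (1 + 0.9 * η) ^ k := pow_le_pow_right₀ (by linarith) hik
  have h3 := pow_le_pow_left₀ (by linarith) ((add_comm _ _).trans_le (Real.add_one_le_exp (0.9 * η))) k
  linarith

end Stability

end SymmSeries

/-! ### Power traces of a state as power sums of its spectrum -/

namespace DensityMatrix

open SymmSeries

variable {d : ℕ} (ρ : DensityMatrix d)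

/-- The eigenvalues of a state. -/
noncomputable def eig : Fin d → ℝ := ρ.posSemidef.isHermitian.eigenvalues

theorem eig_nonneg (a : Fin d) : 0 ≤ ρ.eig a := ρ.posSemidef.eigenvalues_nonneg a

theorem trace_pow (i : ℕ) : (ρ.mat ^ i).trace = ((∑ a, ρ.eig a ^ i : ℝ) : ℂ) := by
  conv_lhs => rw [ρ.posSemidef.isHermitian.spectral_theorem, ← map_pow,
    Unitary.conjStarAlgAut_apply, Matrix.trace_mul_comm, ← mul_assoc, Unitary.coe_star_mul_self,
    one_mul, Matrix.diagonal_pow, Matrix.trace_diagonal]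
  simp [eig]

/-- The indices of the nonzero eigenvalues. -/
noncomputable def support : Finset (Fin d) := Finset.univ.filter fun a => ρ.eig a ≠ 0

theorem card_support : ρ.support.card = ρ.rank := by
  rw [rank, ρ.posSemidef.isHermitian.rank_eq_card_non_zero_eigs, Fintype.card_subtype]
  rfl

/-- Zero eigenvalues do not contribute to positive powers; at `i = 0` they would, through `0^0 = 1`.
-/
theorem sum_support_pow {i : ℕ} (hi : 1 ≤ i) : ∑ a ∈ ρ.support, ρ.eig a ^ i = ρ.powTrace i := by
  rw [powTrace, trace_pow, Complex.ofReal_re, support, Finset.sum_filter_of_ne]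
  intro a _ h h0
  rw [h0, zero_pow (by omega)] at h
  exact h rfl

theorem sum_support : ∑ a ∈ ρ.support, ρ.eig a = 1 := by
  have := ρ.sum_support_pow le_rfl
  simp only [pow_one] at this
  rw [this, powTrace, pow_one, ρ.trace_eq_one, Complex.one_re]

variable {r k : ℕ} {ε : ℝ} {Q : ℕ → ℝ}

theorem abs_extendPowerSums_sub_powTrace_lt (hr : ρ.rank = r)
    {η : ℝ} (hη : 0 ≤ η) (hε : 0 < ε) (hε1 : ε ≤ 1)
    (hk : k * (η * (1 + Real.log r)) < ε * Real.log 2)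
    (hQ : ∀ j, 1 ≤ j → j ≤ r → |Q j - ρ.powTrace j| ≤ η) {i : ℕ} (hi : 1 ≤ i) (hik : i ≤ k) :
    |extendPowerSums r Q i - ρ.powTrace i| < ε := by
  rw [← ρ.sum_support_pow hi]
  refine abs_extendPowerSums_sub_lt ρ.eig_nonneg ρ.sum_support (hr ▸ ρ.card_support.le) hη hε hε1 hk
    (fun j h1 h2 => ?_) hi hik
  rw [ρ.sum_support_pow h1]
  exact hQ j h1 h2

theorem sufficient_accuracy (hr : ρ.rank = r) (hr2 : 2 ≤ r) (hk : 1 ≤ k) (hε : 0 < ε) (hε1 : ε ≤ 1)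
    (hQ : ∀ j, 1 ≤ j → j ≤ r → |Q j - ρ.powTrace j| < ε / (k * r * Real.log r))
    {i : ℕ} (hi : 1 ≤ i) (hik : i ≤ k) :
    |extendPowerSums r Q i - ρ.powTrace i| < ε := by
  have hl2 := Real.log_two_gt_d9
  have hk' : (1 : ℝ) ≤ k := by exact_mod_cast hk
  have hr' : (2 : ℝ) ≤ r := by exact_mod_cast hr2
  have hlr : Real.log 2 ≤ Real.log r := Real.log_le_log (by norm_num) hr'
  have hlr0 : 0 < Real.log r := by linarith
  -- Up to `r` nothing is continued, and `k r log r ≥ 2 log 2 > 1` makes the hypothesis strong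
  -- enough.
  by_cases hir : i ≤ r
  · rw [extendPowerSums_of_le hir]
    refine (hQ i hi hir).trans_le (div_le_self hε.le ?_)
    have h1 : 2 ≤ (k : ℝ) * r := by nlinarith
    nlinarith
  -- The general bound requires `(1 + log r) / (r log r) < log 2`, which holds from `r = 3` on but
  -- fails at `r = 2`, where the left side is about `1.22`.
  by_cases h2 : r = 2
  · subst h2
    rw [← ρ.sum_support_pow hi]
    refine abs_extendPowerSums_two_sub_lt ρ.eig_nonneg ρ.sum_support (hr ▸ ρ.card_support.le)
      hε hε1 (fun j h1 h2 => ?_) (by omega) hik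
    rw [ρ.sum_support_pow h1]
    exact_mod_cast (hQ j h1 h2).le
  · have hr3 : (3 : ℝ) ≤ r := by exact_mod_cast (by omega : 3 ≤ r)
    refine ρ.abs_extendPowerSums_sub_powTrace_lt hr (η := ε / (k * r * Real.log r)) (by positivity)
      hε hε1 ?_ (fun j h1 h2 => (hQ j h1 h2).le) hi hik
    -- `exp 1.09 = exp 1 · exp 0.09 ≤ 2.7183 / 0.91 < 3`.
    have hl3 : 1.09 ≤ Real.log r := by
      refine le_trans ?_ (Real.log_le_log (by norm_num) hr3)
      rw [Real.le_log_iff_exp_le (by norm_num)]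
      have h1 : Real.exp 1.09 = Real.exp 1 * Real.exp 0.09 := by rw [← Real.exp_add]; norm_num
      have h3 := Real.exp_one_lt_d9
      have h4 : Real.exp 0.09 ≤ 1 / (1 - 0.09) := by
        rw [le_div_iff₀ (by norm_num), ← le_div_iff₀' (Real.exp_pos _), one_div,
          ← Real.exp_neg]
        exact Real.one_sub_le_exp_neg _
      rw [h1]
      have := mul_le_mul h3.le h4 (Real.exp_pos _).le (by norm_num)
      refine this.trans ?_
      norm_num
    have h1 : k * (ε / (k * r * Real.log r) * (1 + Real.log r)) =
        ε * ((1 + Real.log r) / (r * Real.log r)) := by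
      field_simp
    rw [h1]
    refine mul_lt_mul_of_pos_left ?_ hε
    rw [div_lt_iff₀ (by positivity)]
    have h3 : 2 ≤ Real.log 2 * r := by nlinarith
    have h4 := mul_le_mul_of_nonneg_right h3 hlr0.le
    linarith

end DensityMatrix

/-! ## Concentration of the estimates -/

namespace Estimation

open MeasureTheory ProbabilityTheory

theorem abs_signValue_le (x : Bool) : signValue x ∈ Set.Icc (-1 : ℝ) 1 := by
  cases x <;> simp [signValue]

/-- Hoeffding's inequality for the sum of independent signs. -/
theorem measureReal_sum_signValue_ge_le (ν : Measure Bool) [IsProbabilityMeasure ν] {m : ℝ}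
    (hm : ∫ x, signValue x ∂ν = m) {N : ℕ} (hN : 0 < N) {η : ℝ} (hη : 0 ≤ η) :
    (Measure.pi fun _ : Fin N => ν).real {ω | η ≤ |(∑ i, signValue (ω i)) / N - m|} ≤
      2 * Real.exp (-(N * η ^ 2 / 2)) := by
  have hN' : (0 : ℝ) < N := by exact_mod_cast hN
  have hsub : HasSubgaussianMGF (fun x => signValue x - m) 1 ν := by
    have h := hasSubgaussianMGF_of_mem_Icc (μ := ν) (X := signValue)
      (measurable_of_finite _).aemeasurable (ae_of_all _ abs_signValue_le)
    rw [hm] at h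
    -- The variance proxy in Hoeffding's lemma is the square of half the range.
    have h1 : (‖(1 : ℝ) - -1‖₊ / 2) ^ 2 = 1 := by
      have : ‖(1 : ℝ) - -1‖₊ = 2 := by
        ext
        simp
        norm_num
      rw [this]
      simp
    rwa [h1] at h
  -- Stated for general `Y` in order to serve both the upper and the lower deviation.
  have tail : ∀ Y : Bool → ℝ, HasSubgaussianMGF Y 1 ν →
      (Measure.pi fun _ : Fin N => ν).real {ω | N * η ≤ ∑ i, Y (ω i)} ≤
        Real.exp (-(N * η ^ 2 / 2)) := by
    intro Y hY
    have hind : iIndepFun (fun (i : Fin N) (ω : Fin N → Bool) => Y (ω i))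
        (Measure.pi fun _ : Fin N => ν) :=
      iIndepFun_pi (X := fun _ => Y) fun _ => (measurable_of_finite _).aemeasurable
    have hs : ∀ i ∈ Finset.univ, HasSubgaussianMGF (fun ω : Fin N → Bool => Y (ω i)) 1
        (Measure.pi fun _ : Fin N => ν) := fun i _ => by
      refine HasSubgaussianMGF.of_map (Y := fun ω : Fin N → Bool => ω i) (X := Y)
        (measurable_pi_apply i).aemeasurable ?_
      rwa [(measurePreserving_eval (fun _ : Fin N => ν) i).map_eq]
    refine (HasSubgaussianMGF.measure_sum_ge_le_of_iIndepFun hind hs (by positivity)).trans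
      (le_of_eq ?_)
    congr 1
    simp
    field_simp
  have h1 := tail _ hsub
  have h2 := tail _ hsub.neg
  have hsum : ∀ ω : Fin N → Bool, ∑ i, (signValue (ω i) - m) =
      N * ((∑ i, signValue (ω i)) / N - m) := fun ω => by
    rw [Finset.sum_sub_distrib]
    simp
    field_simp
  refine (measureReal_mono (s₂ := {ω | N * η ≤ ∑ i, (signValue (ω i) - m)} ∪
    {ω | N * η ≤ ∑ i, (-fun x => signValue x - m) (ω i)}) ?_ (measure_ne_top _ _)).trans
    ((measureReal_union_le _ _).trans (by linarith))
  intro ω hω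
  simp only [Pi.neg_apply, Finset.sum_neg_distrib, Set.mem_union, Set.mem_ofPred_eq, hsum] at hω ⊢
  rcases le_abs.mp hω with h | h
  · exact Or.inl (mul_le_mul_of_nonneg_left h hN'.le)
  · refine Or.inr ?_
    rw [← mul_neg]
    exact mul_le_mul_of_nonneg_left h hN'.le

/-- The expected value of one run is the power trace. -/
def Unbiased (circ : ∀ j : ℕ, QCircuit j) : Prop :=
  ∀ (j d : ℕ) (ρ : DensityMatrix d), 1 ≤ j →
    ∑ x, ((circ j).runPMF ρ x).toReal * signValue x = ρ.powTrace j

variable {circ : ∀ j : ℕ, QCircuit j} {d : ℕ} {ρ : DensityMatrix d} {r N : ℕ}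

instance : IsProbabilityMeasure (runsMeasure circ ρ r N) := by
  unfold runsMeasure
  infer_instance

theorem measureReal_empiricalPowTrace_ge_le (h : Unbiased circ) (hN : 0 < N) {η : ℝ} (hη : 0 ≤ η)
    {j : ℕ} (hj : 1 ≤ j) (hjr : j ≤ r) :
    (runsMeasure circ ρ r N).real {ω | η ≤ |empiricalPowTrace ω j - ρ.powTrace j|} ≤
      2 * Real.exp (-(N * η ^ 2 / 2)) := by
  obtain ⟨j, rfl⟩ : ∃ i, j = i + 1 := ⟨j - 1, by omega⟩
  set ν := ((circ (j + 1)).runPMF ρ).toMeasure with hν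
  have hm : ∫ x, signValue x ∂ν = ρ.powTrace (j + 1) := by
    rw [← h (j + 1) d ρ hj, hν, PMF.integral_eq_sum]
    rfl
  refine le_trans (le_of_eq ?_) (measureReal_sum_signValue_ge_le ν hm hN hη)
  have hp := measurePreserving_eval (fun j : Fin r => Measure.pi fun _ : Fin N =>
    ((circ ((j : ℕ) + 1)).runPMF ρ).toMeasure) ⟨j, by omega⟩
  rw [hν, ← hp.measureReal_preimage (Set.toFinite _).measurableSet.nullMeasurableSet]
  congr 1
  ext ω
  simp [empiricalPowTrace, hjr]

theorem le_measureReal_accurate (h : Unbiased circ) (hN : 0 < N) {η δ : ℝ} (hη : 0 ≤ η)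
    (hδ : 2 * Real.exp (-(N * η ^ 2 / 2)) ≤ δ) {j : ℕ} (hj : 1 ≤ j) (hjr : j ≤ r) :
    1 - δ ≤ (runsMeasure circ ρ r N).real
      {ω | |empiricalPowTrace ω j - ρ.powTrace j| < η} := by
  have h1 := measureReal_empiricalPowTrace_ge_le (ρ := ρ) h hN hη hj hjr
  have h2 := probReal_compl_eq_one_sub (μ := runsMeasure circ ρ r N)
    (s := {ω | |empiricalPowTrace ω j - ρ.powTrace j| < η}) (Set.toFinite _).measurableSet
  have h3 : {ω : Outcomes r N | |empiricalPowTrace ω j - ρ.powTrace j| < η}ᶜ =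
      {ω | η ≤ |empiricalPowTrace ω j - ρ.powTrace j|} := by
    ext ω
    simp
  rw [h3] at h2
  linarith

/-- Union bound over the `r` circuits. The event `A` is left open so that `η` need not be the
accuracy demanded of the single estimates. -/
theorem le_measureReal_simultaneous (h : Unbiased circ) (hN : 0 < N) {η δ : ℝ} (hη : 0 ≤ η)
    (hδ : r * (2 * Real.exp (-(N * η ^ 2 / 2))) ≤ δ) {A : Set (Outcomes r N)}
    (hA : ∀ ω : Outcomes r N,
      (∀ j, 1 ≤ j → j ≤ r → |empiricalPowTrace ω j - ρ.powTrace j| ≤ η) → ω ∈ A) :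
    1 - δ ≤ (runsMeasure circ ρ r N).real A := by
  have h1 : (runsMeasure circ ρ r N).real (⋃ j ∈ Finset.Icc 1 r,
      {ω | η ≤ |empiricalPowTrace ω j - ρ.powTrace j|}) ≤ δ := by
    refine (measureReal_biUnion_finset_le _ _).trans ?_
    refine (Finset.sum_le_sum fun j hj => ?_).trans (b := ∑ j ∈ Finset.Icc 1 r,
      2 * Real.exp (-(N * η ^ 2 / 2))) ?_
    · rw [Finset.mem_Icc] at hj
      exact measureReal_empiricalPowTrace_ge_le h hN hη hj.1 hj.2
    · simpa using hδ
  have h2 := probReal_compl_eq_one_sub (μ := runsMeasure circ ρ r N) (s := A)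
    (Set.toFinite _).measurableSet
  have h3 : (runsMeasure circ ρ r N).real Aᶜ ≤ (runsMeasure circ ρ r N).real
      (⋃ j ∈ Finset.Icc 1 r, {ω | η ≤ |empiricalPowTrace ω j - ρ.powTrace j|}) := by
    refine measureReal_mono (fun ω hω => ?_) (measure_ne_top _ _)
    by_contra hc
    refine hω (hA ω fun j h1 h2 => ?_)
    by_contra h4
    refine hc (Set.mem_biUnion (Finset.mem_coe.mpr (Finset.mem_Icc.mpr ⟨h1, h2⟩)) ?_)
    exact (not_le.mp h4).le
  linarith

/-- The number of runs of each circuit that suffices. -/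
theorem exists_numRuns (h : Unbiased circ) {δ₀ : ℝ} (hδ₀ : 0 < δ₀) (hδ₁ : δ₀ < 1) :
    ∃ C : ℝ, 0 < C ∧ ∀ (r k : ℕ) (ε δ : ℝ), 2 ≤ r → 1 ≤ k → 0 < ε → ε ≤ 1 → 0 < δ → δ ≤ δ₀ →
      ∃ N : ℕ,
        (N : ℝ) ≤ C * (k ^ 2 * r ^ 2 * Real.log r ^ 2 / ε ^ 2 * Real.log (1 / δ)) ∧
        (∑ j ∈ Finset.Icc 1 r, (j : ℝ) * N) ≤
          C * (k ^ 2 * r ^ 4 * Real.log r ^ 2 / ε ^ 2 * Real.log (1 / δ)) ∧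
        ∀ (d : ℕ) (ρ : DensityMatrix d), ρ.rank = r →
          (∀ j, 1 ≤ j → j ≤ r →
            1 - δ ≤ (runsMeasure circ ρ r N).real
              {ω | |empiricalPowTrace ω j - ρ.powTrace j| < ε / (k * r * Real.log r)}) ∧
          1 - δ ≤ (runsMeasure circ ρ r N).real
            {ω | ∀ i, 1 ≤ i → i ≤ k →
              |extendPowerSums r (empiricalPowTrace ω) i - ρ.powTrace i| < ε} := by
  set L₀ := Real.log (1 / δ₀) with hL₀
  have hL₀0 : 0 < L₀ := Real.log_pos (by rw [lt_div_iff₀ hδ₀]; linarith)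
  -- `32 = 2 · 4^2` comes from the exponent `N η^2 / 2` and the accuracy `ε / (4 k log r)`. The
  -- first `1 / L₀` turns `L + 1` into a multiple of `L ≥ L₀`, the second pays for rounding `N` up;
  -- this is why `δ` stays away from `1`.
  refine ⟨32 * (1 + 1 / L₀) + 1 / L₀, by positivity, ?_⟩
  intro r k ε δ hr hk hε hε1 hδ hδδ₀
  have hl2 := Real.log_two_gt_d9
  have hk' : (1 : ℝ) ≤ k := by exact_mod_cast hk
  have hr' : (2 : ℝ) ≤ r := by exact_mod_cast hr
  have hlr : Real.log 2 ≤ Real.log r := Real.log_le_log (by norm_num) hr'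
  have hlr0 : 0 < Real.log r := by linarith
  set L := Real.log (1 / δ) with hL
  have hLL : L₀ ≤ L := Real.log_le_log (by positivity) (one_div_le_one_div_of_le hδ hδδ₀)
  have hL0 : 0 < L := hL₀0.trans_le hLL
  have hδL : Real.exp (-L) = δ := by
    rw [hL, one_div, Real.log_inv, neg_neg, Real.exp_log hδ]
  set X := (k : ℝ) ^ 2 * r ^ 2 * Real.log r ^ 2 / ε ^ 2 with hX
  have hX1 : 1 ≤ X := by
    rw [hX, ← mul_pow, ← mul_pow, ← div_pow]
    refine one_le_pow₀ ?_
    rw [le_div_iff₀ hε, one_mul]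
    have h1 : 2 ≤ (k : ℝ) * r := by nlinarith
    nlinarith
  set A := 32 * (1 + 1 / L₀) with hA
  have hA0 : 0 < A := by positivity
  have hAL : 32 * (L + 1) ≤ A * L := by
    have : 1 ≤ 1 / L₀ * L := by
      rw [one_div_mul_eq_div, le_div_iff₀ hL₀0]
      linarith
    rw [hA]
    linarith
  set N := ⌈A * (X * L)⌉₊ with hN
  have hXL : 0 < X * L := by positivity
  have hN1 : A * (X * L) ≤ N := Nat.le_ceil _
  have hN0 : 0 < N := Nat.ceil_pos.mpr (by positivity)
  have hN2 : (N : ℝ) ≤ (A + 1 / L₀) * (X * L) := by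
    refine (Nat.ceil_lt_add_one (by positivity)).le.trans ?_
    have : 1 ≤ 1 / L₀ * (X * L) := by
      rw [one_div_mul_eq_div, le_div_iff₀ hL₀0]
      nlinarith
    linarith
  refine ⟨N, hN2, ?_, fun d ρ hρ => ⟨fun j hj hjr => ?_, ?_⟩⟩
  · have h1 : ∑ j ∈ Finset.Icc 1 r, (j : ℝ) * N ≤ ∑ _j ∈ Finset.Icc 1 r, (r : ℝ) * N := by
      refine Finset.sum_le_sum fun j hj => ?_
      rw [Finset.mem_Icc] at hj
      exact mul_le_mul_of_nonneg_right (by exact_mod_cast hj.2) (Nat.cast_nonneg _)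
    refine h1.trans ?_
    rw [Finset.sum_const, Nat.card_Icc, Nat.add_sub_cancel, nsmul_eq_mul]
    have h2 := mul_le_mul_of_nonneg_left hN2 (by positivity : (0 : ℝ) ≤ (r : ℝ) * r)
    refine (le_of_eq ?_).trans (h2.trans (le_of_eq ?_))
    · ring
    · rw [hX]
      ring
  · refine le_measureReal_accurate h hN0 (by positivity) ?_ hj hjr
    have h1 : A * L ≤ N * (ε / (k * r * Real.log r)) ^ 2 := by
      refine le_trans (le_of_eq ?_) (mul_le_mul_of_nonneg_right hN1 (sq_nonneg _))
      rw [hX]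
      field_simp
    have h2 : 2 * Real.exp (-(L + 1)) ≤ δ := by
      rw [neg_add, Real.exp_add, hδL]
      have : Real.exp (-1) ≤ 1 / 2 := by
        rw [Real.exp_neg, one_div]
        refine inv_anti₀ (by norm_num) ?_
        linarith [Real.add_one_le_exp (1 : ℝ)]
      nlinarith
    refine le_trans ?_ h2
    have : Real.exp (-(N * (ε / (k * r * Real.log r)) ^ 2 / 2)) ≤ Real.exp (-(L + 1)) :=
      Real.exp_le_exp.mpr (by linarith)
    linarith
  -- The accuracy used here is `r / 4` times `ε / (k r log r)`. The exponent thereby gains a term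
  -- `r^2`, which absorbs the factor `2 r` of the union bound.
  · refine le_measureReal_simultaneous (η := ε / (4 * k * Real.log r)) h hN0 (by positivity) ?_ ?_
    · have h1 : A * L * r ^ 2 ≤ N * (ε / (4 * k * Real.log r)) ^ 2 * 16 := by
        refine le_trans (le_of_eq ?_) (mul_le_mul_of_nonneg_right
          (mul_le_mul_of_nonneg_right hN1 (sq_nonneg _)) (by norm_num))
        rw [hX]
        field_simp
        ring
      have h3 : L + r ^ 2 ≤ N * (ε / (4 * k * Real.log r)) ^ 2 / 2 := by
        have h4 : (1 : ℝ) ≤ r ^ 2 := one_le_pow₀ (by linarith)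
        have h5 := mul_le_mul_of_nonneg_right hAL (sq_nonneg (r : ℝ))
        nlinarith
      have h4 : Real.exp (-(N * (ε / (4 * k * Real.log r)) ^ 2 / 2)) ≤
          Real.exp (-(L + r ^ 2)) := Real.exp_le_exp.mpr (by linarith)
      have h5 : 2 * r * Real.exp (-(r : ℝ) ^ 2) ≤ 1 := by
        rw [Real.exp_neg, ← div_eq_mul_inv, div_le_one (Real.exp_pos _)]
        nlinarith [Real.add_one_le_exp ((r : ℝ) ^ 2), sq_nonneg ((r : ℝ) - 1)]
      rw [neg_add, Real.exp_add, hδL] at h4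
      have h6 := mul_le_mul_of_nonneg_left h4 (by positivity : (0 : ℝ) ≤ 2 * r)
      have h7 := mul_le_mul_of_nonneg_left h5 hδ.le
      linarith
    · intro ω hω i hi hik
      refine ρ.abs_extendPowerSums_sub_powTrace_lt hρ (η := ε / (4 * k * Real.log r))
        (by positivity) hε hε1 ?_ hω hi hik
      have h1 : k * (ε / (4 * k * Real.log r) * (1 + Real.log r)) =
          ε * ((1 + Real.log r) / (4 * Real.log r)) := by
        field_simp
      rw [h1]
      -- The factor `4` makes `1 + log r < 4 log 2 log r` true from `r = 2` on, so no separate case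
      -- is needed.
      refine mul_lt_mul_of_pos_left ?_ hε
      rw [div_lt_iff₀ (by positivity)]
      nlinarith

end Estimation

/-! ## The action of circuit layers on matrix entries -/

namespace QCircuit

variable {a c m d : ℕ}

/-- Set a qubit of a basis vector. -/
def upd (x : Basis a m d) (q : Fin a) (v : Bool) : Basis a m d := (Function.update x.1 q v, x.2)

theorem sum_upd (q : Fin a) (F : Basis a m d → Bool → ℂ) :
    ∑ x, ∑ w : Bool, F (upd x q w) (x.1 q) = ∑ x, ∑ v : Bool, F x v := by
  rw [← Fintype.sum_prod_type', ← Fintype.sum_prod_type']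
  refine Fintype.sum_bijective
    (fun p : Basis a m d × Bool => (upd p.1 q p.2, p.1.1 q)) ?_ _ _ fun _ => rfl
  refine Function.Involutive.bijective fun p => ?_
  simp [upd]

/-- The sign of a bit. -/
def sgn (v : Bool) : ℂ := if v then -1 else 1

theorem sum_hadamardOp (q : Fin a) (x : Basis a m d) (F : Basis a m d → ℂ) :
    ∑ z, hadamardOp q x z * F z = ∑ v : Bool, sgn (x.1 q && v) / (Real.sqrt 2 : ℂ) * F (upd x q v) := by
  symm
  refine Fintype.sum_of_injective (fun v => upd x q v) ?_ _ _ ?_ ?_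
  · intro v w h
    have := congrFun (congrArg Prod.fst h) q
    simpa [upd] using this
  · intro z hz
    rw [hadamardOp, Matrix.of_apply, if_neg, zero_mul]
    rintro ⟨h1, h2⟩
    exact hz ⟨z.1 q, Prod.ext h1 h2⟩
  · intro v
    simp [hadamardOp, upd, sgn]

theorem apply_hadamard (q : Fin a) (σ : HybridState a c m d) (b : Fin c → Bool)
    (x y : Basis a m d) :
    (Op.hadamard q : Op a c m).apply σ b x y = 1 / 2 * ∑ v : Bool, ∑ w : Bool,
      sgn (x.1 q && v) * sgn (y.1 q && w) * σ b (upd x q v) (upd y q w) := by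
  have hs : ∀ z, (starRingEnd ℂ) (hadamardOp q y z) = hadamardOp q y z := fun z => by
    simp only [hadamardOp, Matrix.of_apply]
    split_ifs <;> simp
  have h2 : (Real.sqrt 2 : ℂ) * (Real.sqrt 2 : ℂ) = 2 := by
    rw [← Complex.ofReal_mul, Real.mul_self_sqrt (by norm_num)]
    norm_num
  have h0 : (Real.sqrt 2 : ℂ) ≠ 0 := by
    intro h
    rw [h] at h2
    norm_num at h2
  simp only [Op.apply]
  rw [Matrix.mul_assoc, Matrix.mul_apply, sum_hadamardOp, Finset.mul_sum]
  refine Finset.sum_congr rfl fun v _ => ?_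
  rw [Matrix.mul_apply]
  simp only [Matrix.conjTranspose_apply, RCLike.star_def, hs]
  rw [Finset.sum_congr rfl fun z _ => mul_comm _ _, sum_hadamardOp, Finset.mul_sum, Finset.mul_sum]
  refine Finset.sum_congr rfl fun w _ => ?_
  field_simp
  rw [pow_two, h2]
  ring

theorem apply_measure (q : Fin a) (k : Fin c) (σ : HybridState a c m d) (b : Fin c → Bool)
    (x y : Basis a m d) :
    (Op.measure q k : Op a c m).apply σ b x y =
      if x.1 q = b k ∧ y.1 q = b k then ∑ w : Bool, σ (Function.update b k w) x y else 0 := by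
  simp only [Op.apply, projOp, Matrix.sum_apply, Matrix.diagonal_conjTranspose,
    Matrix.mul_diagonal, Matrix.diagonal_mul]
  by_cases h1 : x.1 q = b k <;> by_cases h2 : y.1 q = b k <;> simp [h1, h2]

/-! ### Reversible operations -/

/-- An involution is its own inverse, so conjugation just substitutes `f` in both indices.
Reversible gates thus become changes of variables. -/
theorem basisMap_conj {f : Basis a m d → Basis a m d} (hf : Function.Involutive f)
    (M : Operator a m d) (x y : Basis a m d) :
    (basisMap f * M * (basisMap f)ᴴ) x y = M (f x) (f y) := by
  have h : ∀ x z, basisMap f x z = if z = f x then 1 else 0 := fun x z => by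
    simp only [basisMap, Matrix.of_apply]
    congr 1
    rw [eq_iff_iff]
    exact ⟨fun h => by rw [h, hf], fun h => by rw [h, hf]⟩
  simp [Matrix.mul_apply, h, apply_ite]

/-- The operations that permute the computational basis. -/
def Op.IsReversible : Op a c m → Prop
  | .hadamard _ => False
  | .measure _ _ => False
  | _ => True

/-- The permutation of the computational basis belonging to a reversible operation. -/
def Op.pull (b : Fin c → Bool) : Op a c m → Basis a m d → Basis a m d
  | .cnot p q _ => cnotFun p q
  | .cswap q u v _ => cswapFun q u v
  | .condX q s => if parity s b then xFun q else id
  | _ => id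

theorem apply_of_isReversible {o : Op a c m} (h : o.IsReversible) (σ : HybridState a c m d)
    (b : Fin c → Bool) (x y : Basis a m d) : o.apply σ b x y = σ b (o.pull b x) (o.pull b y) := by
  cases o with
  | hadamard q => exact h.elim
  | measure q k => exact h.elim
  | cnot p q hpq => exact basisMap_conj (cnotFun_involutive hpq) _ _ _
  | cswap q u v _ => exact basisMap_conj (cswapFun_involutive q u v) _ _ _
  | condX q s =>
    simp only [Op.apply, Op.pull]
    split_ifs
    · exact basisMap_conj (xFun_involutive q) _ _ _
    · rfl

/-- The composition of the permutations belonging to a list of operations. -/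
def pullList (b : Fin c → Bool) (l : List (Op a c m)) (x : Basis a m d) : Basis a m d :=
  l.foldr (fun o z => o.pull b z) x

/-- Entries are pulled back, so the last gate acts first on the indices; hence the `foldr` in
`pullList`. -/
theorem foldl_of_isReversible {l : List (Op a c m)} (h : ∀ o ∈ l, o.IsReversible)
    (σ : HybridState a c m d) (b : Fin c → Bool) (x y : Basis a m d) :
    l.foldl (fun σ o => o.apply σ) σ b x y = σ b (pullList b l x) (pullList b l y) := by
  induction l generalizing σ with
  | nil => rfl
  | cons o l ih =>
    rw [List.foldl_cons, ih fun o' ho' => h o' (List.mem_cons_of_mem _ ho'),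
      apply_of_isReversible (h o List.mem_cons_self)]
    rfl

section Cnot

variable {ι : Type*} {p t : ι → Fin a} {h : ∀ i k, p i ≠ t k}

theorem pullList_cnot_snd (b : Fin c → Bool) (is : List ι) (x : Basis a m d) :
    (pullList b (is.map fun i => (Op.cnot (p i) (t i) (h i i) : Op a c m)) x).2 = x.2 := by
  induction is with
  | nil => rfl
  | cons i is ih => exact ih

theorem pullList_cnot_of_notMem (b : Fin c → Bool) (is : List ι) (x : Basis a m d) {u : Fin a}
    (hu : ∀ i, t i ≠ u) :
    (pullList b (is.map fun i => (Op.cnot (p i) (t i) (h i i) : Op a c m)) x).1 u = x.1 u := by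
  induction is with
  | nil => rfl
  | cons i is ih =>
    refine Eq.trans ?_ ih
    exact Function.update_of_ne (hu i).symm _ _

/-- No control is a target and the targets are distinct, so the gates do not interfere. -/
theorem pullList_cnot_target [DecidableEq ι] (ht : Function.Injective t) (b : Fin c → Bool)
    {is : List ι} (his : is.Nodup) (x : Basis a m d) (i : ι) :
    (pullList b (is.map fun i => (Op.cnot (p i) (t i) (h i i) : Op a c m)) x).1 (t i) =
      if i ∈ is then xor (x.1 (p i)) (x.1 (t i)) else x.1 (t i) := by
  induction is with
  | nil => rfl
  | cons k is ih =>
    rw [List.nodup_cons] at his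
    have hp := pullList_cnot_of_notMem (p := p) (t := t) (h := h) b is x (u := p k)
      fun i => (h k i).symm
    by_cases hik : i = k
    · subst hik
      refine (Function.update_self _ _ _).trans ?_
      rw [if_pos List.mem_cons_self]
      have h2 := ih his.2
      rw [if_neg his.1] at h2
      exact congrArg₂ _ hp h2
    · refine (Function.update_of_ne (fun h => hik (ht h)) _ _).trans ?_
      refine (ih his.2).trans ?_
      simp [hik]

end Cnot

section CondX

variable {ι : Type*} {q : ι → Fin a} {s : ι → Finset (Fin c)}

theorem pull_condX (b : Fin c → Bool) (q : Fin a) (s : Finset (Fin c)) (x : Basis a m d) :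
    ((Op.condX q s : Op a c m).pull b x) = upd x q (xor (parity s b) (x.1 q)) := by
  rw [Op.pull]
  split_ifs with h
  · simp [h, xFun, upd]
  · simp [h, upd]

theorem pullList_condX_snd (b : Fin c → Bool) (is : List ι) (x : Basis a m d) :
    (pullList b (is.map fun i => (Op.condX (q i) (s i) : Op a c m)) x).2 = x.2 := by
  induction is with
  | nil => rfl
  | cons i is ih =>
    have h := congrArg Prod.snd (pull_condX b (q i) (s i)
      (pullList b (is.map fun i => (Op.condX (q i) (s i) : Op a c m)) x))
    exact h.trans ih

theorem pullList_condX_of_notMem (b : Fin c → Bool) (is : List ι) (x : Basis a m d) {u : Fin a}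
    (hu : ∀ i, q i ≠ u) :
    (pullList b (is.map fun i => (Op.condX (q i) (s i) : Op a c m)) x).1 u = x.1 u := by
  induction is with
  | nil => rfl
  | cons i is ih =>
    refine Eq.trans ?_ ih
    refine (congrFun (congrArg Prod.fst (pull_condX b (q i) (s i) _)) u).trans ?_
    exact Function.update_of_ne (hu i).symm _ _

theorem pullList_condX_target [DecidableEq ι] (hq : Function.Injective q) (b : Fin c → Bool)
    {is : List ι} (his : is.Nodup) (x : Basis a m d) (i : ι) :
    (pullList b (is.map fun i => (Op.condX (q i) (s i) : Op a c m)) x).1 (q i) =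
      if i ∈ is then xor (parity (s i) b) (x.1 (q i)) else x.1 (q i) := by
  induction is with
  | nil => rfl
  | cons k is ih =>
    rw [List.nodup_cons] at his
    refine (congrFun (congrArg Prod.fst (pull_condX b (q k) (s k) _)) (q i)).trans ?_
    by_cases hik : i = k
    · subst hik
      refine (Function.update_self _ _ _).trans ?_
      rw [if_pos List.mem_cons_self]
      have h2 := ih his.2
      rw [if_neg his.1] at h2
      exact congrArg₂ _ rfl h2
    · refine (Function.update_of_ne (fun h => hik (hq h)) _ _).trans ?_
      refine (ih his.2).trans ?_
      simp [hik]

end CondX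

section CSwap

/-- The controlled swap of `i` and `s i`, where `i < s i`, with control qubit `q i`. -/
def swapOp (q : Fin m → Fin a) (s : Fin m → Fin m) (i : Fin m) : Option (Op a c m) :=
  if h : i < s i then some (Op.cswap (q i) i (s i) h.ne) else none

variable {q : Fin m → Fin a} {s : Fin m → Fin m}

theorem pullList_swapOp_fst (b : Fin c → Bool) (is : List (Fin m)) (x : Basis a m d) :
    (pullList b (is.filterMap (swapOp q s) : List (Op a c m)) x).1 = x.1 := by
  induction is with
  | nil => rfl
  | cons i is ih =>
    by_cases h : i < s i
    · rw [List.filterMap_cons_some (b := Op.cswap (q i) i (s i) h.ne) (by simp [swapOp, h])]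
      exact ih
    · rw [List.filterMap_cons_none (by simp [swapOp, h])]
      exact ih

/-- Each two-cycle of `s` is carried out at its smaller element; the disjunction says from which end
`u` sees it. The common control value `v` is what a cat state supplies. -/
theorem pullList_swapOp_snd (hs : Function.Involutive s) (b : Fin c → Bool) {is : List (Fin m)}
    (his : is.Nodup) (x : Basis a m d) {v : Bool} (hx : ∀ i, x.1 (q i) = v) (u : Fin m) :
    (pullList b (is.filterMap (swapOp q s) : List (Op a c m)) x).2 u =
      if v ∧ ((u ∈ is ∧ u < s u) ∨ (s u ∈ is ∧ s u < u)) then x.2 (s u) else x.2 u := by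
  induction is generalizing u with
  | nil => simp [pullList]
  | cons i is ih =>
    rw [List.nodup_cons] at his
    have ih' := ih his.2
    by_cases h : i < s i
    · rw [List.filterMap_cons_some (b := Op.cswap (q i) i (s i) h.ne) (by simp [swapOp, h])]
      have h1 := pullList_swapOp_fst (c := c) (q := q) (s := s) b is x
      have h2 : (pullList b (Op.cswap (q i) i (s i) h.ne :: is.filterMap (swapOp q s)) x).2 =
          if v then (pullList b (is.filterMap (swapOp q s) : List (Op a c m)) x).2 ∘
            Equiv.swap i (s i)
          else (pullList b (is.filterMap (swapOp q s) : List (Op a c m)) x).2 := by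
        rw [← hx i, ← h1]
        rfl
      rw [h2]
      by_cases hv : v = true
      · rw [if_pos hv, Function.comp_apply]
        rcases eq_or_ne u i with rfl | hui
        · rw [Equiv.swap_apply_left, ih', hs u]
          simp [hv, h, his.1, h.not_gt]
        rcases eq_or_ne u (s i) with rfl | hus
        · rw [Equiv.swap_apply_right, ih', hs i]
          simp [hv, h, his.1, h.not_gt]
        · rw [Equiv.swap_apply_of_ne_of_ne hui hus, ih']
          have : s u ≠ i := fun h => hus (by rw [← h, hs])
          simp [hui, this]
      · rw [if_neg hv, ih']
        simp [hv]
    · rw [List.filterMap_cons_none (by simp [swapOp, h]), ih']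
      have h1 : (u ∈ i :: is ∧ u < s u) ↔ (u ∈ is ∧ u < s u) := by
        rw [List.mem_cons]
        refine ⟨?_, fun h => ⟨Or.inr h.1, h.2⟩⟩
        rintro ⟨rfl | h1, h2⟩
        · exact absurd h2 h
        · exact ⟨h1, h2⟩
      have h2 : (s u ∈ i :: is ∧ s u < u) ↔ (s u ∈ is ∧ s u < u) := by
        rw [List.mem_cons]
        refine ⟨?_, fun h => ⟨Or.inr h.1, h.2⟩⟩
        rintro ⟨h1 | h1, h2⟩
        · rw [← h1, hs] at h
          exact absurd h2 h
        · exact ⟨h1, h2⟩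
      simp only [h1, h2]

theorem pullList_swapOp_finRange (hs : Function.Involutive s) (b : Fin c → Bool)
    (x : Basis a m d) {v : Bool} (hx : ∀ i, x.1 (q i) = v) (u : Fin m) :
    (pullList b ((List.finRange m).filterMap (swapOp q s) : List (Op a c m)) x).2 u =
      if v then x.2 (s u) else x.2 u := by
  rw [pullList_swapOp_snd hs b (List.nodup_finRange m) x hx]
  rcases lt_trichotomy u (s u) with h | h | h
  · simp [h]
  · rw [← h]
    simp
  · simp [h]

end CSwap

/-! ### Preparation: Hadamard gates and measurements -/

/-- The qubits outside `A` are `|0⟩`, those of `A` are in a uniform superposition. -/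
noncomputable def uniformState (ρ : DensityMatrix d) (A : Finset (Fin a)) :
    HybridState a c m d := fun b => Matrix.of fun x y =>
  if (b = fun _ => false) ∧ ∀ u ∉ A, x.1 u = false ∧ y.1 u = false then
    (1 / 2) ^ A.card * ∏ i, ρ.mat (x.2 i) (y.2 i) else 0

theorem initState_eq_uniformState (ρ : DensityMatrix d) :
    initState a c m ρ = uniformState ρ ∅ := by
  ext b x y
  by_cases hb : b = fun _ => false
  · by_cases hx : (x.1 = fun _ => false) ∧ (y.1 = fun _ => false)
    · simp [initState, uniformState, hb, hx]
    · have : ¬ ∀ u, x.1 u = false ∧ y.1 u = false := fun h =>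
        hx ⟨funext fun u => (h u).1, funext fun u => (h u).2⟩
      simp [initState, uniformState, hb, hx, this]
  · simp [initState, uniformState, hb]

theorem apply_hadamard_uniformState (ρ : DensityMatrix d) {A : Finset (Fin a)} {q : Fin a}
    (hq : q ∉ A) : (Op.hadamard q : Op a c m).apply (uniformState ρ A) =
      uniformState ρ (insert q A) := by
  ext b x y
  rw [apply_hadamard]
  have h0 : ∀ v w, (v = true ∨ w = true) →
      (uniformState ρ A : HybridState a c m d) b (upd x q v) (upd y q w) = 0 := by
    intro v w hvw
    rw [uniformState, Matrix.of_apply, if_neg]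
    rintro ⟨-, h⟩
    have := h q hq
    simp only [upd, Function.update_self] at this
    rcases hvw with h | h <;> simp [h] at this
  rw [Fintype.sum_bool, Fintype.sum_bool, Fintype.sum_bool, h0 true true (Or.inl rfl),
    h0 true false (Or.inl rfl), h0 false true (Or.inr rfl)]
  simp only [Bool.and_false, sgn, uniformState, Matrix.of_apply]
  have h1 : (∀ u ∉ A, (upd x q false).1 u = false ∧ (upd y q false).1 u = false) ↔
      ∀ u ∉ insert q A, x.1 u = false ∧ y.1 u = false := by
    simp only [upd, Finset.mem_insert, not_or]
    refine forall_congr' fun u => ?_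
    by_cases hu : u = q
    · subst hu
      simp
    · simp [hu]
  simp only [h1, Finset.card_insert_of_notMem hq]
  by_cases hc : (b = fun _ => false) ∧ ∀ u ∉ insert q A, x.1 u = false ∧ y.1 u = false
  · rw [if_pos hc, if_pos hc]
    simp [upd]
    ring
  · rw [if_neg hc, if_neg hc]
    simp

theorem foldl_hadamard_uniformState (ρ : DensityMatrix d) {us : List (Fin a)} (hus : us.Nodup)
    {A : Finset (Fin a)} (hA : ∀ u ∈ us, u ∉ A) :
    (us.map fun u => (Op.hadamard u : Op a c m)).foldl (fun σ o => o.apply σ) (uniformState ρ A) =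
      uniformState ρ (us.toFinset ∪ A) := by
  induction us generalizing A with
  | nil => simp
  | cons u us ih =>
    rw [List.nodup_cons] at hus
    rw [List.map_cons, List.foldl_cons, apply_hadamard_uniformState ρ (hA u List.mem_cons_self),
      ih hus.2]
    · rw [List.toFinset_cons, Finset.union_insert, Finset.insert_union]
    · intro w hw
      rw [Finset.mem_insert, not_or]
      exact ⟨fun h => hus.1 (h ▸ hw), hA w (List.mem_cons_of_mem _ hw)⟩

/-- The state `R` after measurement of the qubits of `A`. -/
def measuredState (R : Operator a m d) (A : Finset (Fin a)) : HybridState a a m d := fun b =>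
  Matrix.of fun x y =>
    if (∀ u ∉ A, b u = false) ∧ ∀ u ∈ A, x.1 u = b u ∧ y.1 u = b u then R x y else 0

theorem apply_measure_measuredState (R : Operator a m d) {A : Finset (Fin a)} {q : Fin a}
    (hq : q ∉ A) : (Op.measure q q : Op a a m).apply (measuredState R A) =
      measuredState R (insert q A) := by
  ext b x y
  rw [apply_measure]
  -- Bit `q` has not been written yet, so only one of the two earlier memory contents contributes.
  have h0 : measuredState R A (Function.update b q true) x y = 0 := by
    rw [measuredState, Matrix.of_apply, if_neg]
    rintro ⟨h, -⟩
    simpa using h q hq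
  rw [Fintype.sum_bool, h0, zero_add]
  simp only [measuredState, Matrix.of_apply]
  rw [← ite_and]
  congr 1
  rw [eq_iff_iff]
  constructor
  · rintro ⟨h1, h2, h3⟩
    refine ⟨fun u hu => ?_, fun u hu => ?_⟩
    · rw [Finset.mem_insert, not_or] at hu
      have := h2 u hu.2
      rwa [Function.update_of_ne hu.1] at this
    · rcases Finset.mem_insert.mp hu with rfl | hu
      · exact h1
      · have := h3 u hu
        rwa [Function.update_of_ne (fun h : u = q => hq (h ▸ hu))] at this
  · rintro ⟨h1, h2⟩
    refine ⟨h2 q (Finset.mem_insert_self _ _), fun u hu => ?_, fun u hu => ?_⟩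
    · by_cases huq : u = q
      · subst huq
        simp
      · rw [Function.update_of_ne huq]
        exact h1 u (by simp [huq, hu])
    · rw [Function.update_of_ne (fun h : u = q => hq (h ▸ hu))]
      exact h2 u (Finset.mem_insert_of_mem hu)

theorem foldl_measure_measuredState (R : Operator a m d) {us : List (Fin a)} (hus : us.Nodup)
    {A : Finset (Fin a)} (hA : ∀ u ∈ us, u ∉ A) :
    (us.map fun u => (Op.measure u u : Op a a m)).foldl (fun σ o => o.apply σ)
      (measuredState R A) = measuredState R (us.toFinset ∪ A) := by
  induction us generalizing A with
  | nil => simp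
  | cons u us ih =>
    rw [List.nodup_cons] at hus
    rw [List.map_cons, List.foldl_cons, apply_measure_measuredState R (hA u List.mem_cons_self),
      ih hus.2]
    · rw [List.toFinset_cons, Finset.union_insert, Finset.insert_union]
    · intro w hw
      rw [Finset.mem_insert, not_or]
      exact ⟨fun h => hus.1 (h ▸ hw), hA w (List.mem_cons_of_mem _ hw)⟩

/-! ### Readout: the parity of a measurement in the `X` basis -/

/-- The expected sign of the bits in `B` and of a measurement of the qubits in `A`. -/
noncomputable def signTrace (A B : Finset (Fin a)) (σ : HybridState a a m d) : ℂ :=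
  ∑ b, ∑ x, (∏ u ∈ A, sgn (x.1 u)) * (∏ u ∈ B, sgn (b u)) * σ b x x

/-- Heisenberg picture: the sign of the recorded outcome is the observable `Z` on `q` before the
measurement. `sum_update` trades the overwritten bit for the outcome. -/
theorem signTrace_apply_measure {A B : Finset (Fin a)} {q : Fin a} (hA : q ∉ A) (hB : q ∉ B)
    (σ : HybridState a a m d) :
    signTrace A (insert q B) ((Op.measure q q : Op a a m).apply σ) = signTrace (insert q A) B σ := by
  have key := sum_update q fun (b : Fin a → Bool) v => ∑ x : Basis a m d,
    (∏ u ∈ A, sgn (x.1 u)) * (sgn v * ∏ u ∈ B, sgn (b u)) * if x.1 q = v then σ b x x else 0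
  refine Eq.trans ?_ (key.trans ?_)
  · refine Finset.sum_congr rfl fun b _ => ?_
    rw [Finset.sum_comm]
    refine Finset.sum_congr rfl fun x _ => ?_
    have h1 : ∀ w, ∏ u ∈ B, sgn (Function.update b q w u) = ∏ u ∈ B, sgn (b u) := fun w =>
      Finset.prod_congr rfl fun u hu => by rw [Function.update_of_ne (by rintro rfl; exact hB hu)]
    simp only [h1, apply_measure, and_self, Finset.prod_insert hB]
    rw [← Finset.mul_sum]
    split_ifs <;> simp
  · refine Finset.sum_congr rfl fun b _ => ?_
    rw [Finset.sum_comm]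
    refine Finset.sum_congr rfl fun x _ => ?_
    rw [Finset.prod_insert hA]
    cases x.1 q <;> simp [sgn]

theorem signTrace_foldl_measure {us : List (Fin a)} (hus : us.Nodup) {A B : Finset (Fin a)}
    (hA : ∀ u ∈ us, u ∉ A) (hB : ∀ u ∈ us, u ∉ B) (σ : HybridState a a m d) :
    signTrace A (us.toFinset ∪ B)
      ((us.map fun u => (Op.measure u u : Op a a m)).foldl (fun σ o => o.apply σ) σ) =
      signTrace (us.toFinset ∪ A) B σ := by
  induction us generalizing B σ with
  | nil => simp
  | cons u us ih =>
    rw [List.nodup_cons] at hus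
    rw [List.map_cons, List.foldl_cons, List.toFinset_cons, Finset.insert_union,
      ← Finset.union_insert, ih hus.2, signTrace_apply_measure, Finset.insert_union]
    · simp [hus.1, hA u List.mem_cons_self]
    · exact hB u List.mem_cons_self
    · exact fun w hw => hA w (List.mem_cons_of_mem _ hw)
    · intro w hw
      rw [Finset.mem_insert, not_or]
      exact ⟨fun h => hus.1 (h ▸ hw), hB w (List.mem_cons_of_mem _ hw)⟩

/-- Flip the qubits in `D`. -/
def flip (D : Finset (Fin a)) (x : Basis a m d) : Basis a m d :=
  (fun u => if u ∈ D then !x.1 u else x.1 u, x.2)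

/-- The expectation of `∏_{u ∈ A} Z_u ∏_{u ∈ D} X_u`. -/
noncomputable def pauliTrace (A D : Finset (Fin a)) (σ : HybridState a c m d) : ℂ :=
  ∑ b, ∑ x, (∏ u ∈ A, sgn (x.1 u)) * σ b x (flip D x)

/-- Heisenberg picture: `H Z H = X`. After reindexing, the sum over `v` is `1 - (-1)^(x_q + w)`,
which leaves only the flipped value `w ≠ x_q`. -/
theorem pauliTrace_apply_hadamard {A D : Finset (Fin a)} {q : Fin a} (hA : q ∉ A) (hD : q ∉ D)
    (σ : HybridState a c m d) :
    pauliTrace (insert q A) D ((Op.hadamard q : Op a c m).apply σ) =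
      pauliTrace A (insert q D) σ := by
  refine Finset.sum_congr rfl fun b _ => ?_
  have key := sum_upd q fun (x : Basis a m d) v => (∏ u ∈ A, sgn (x.1 u)) * (sgn v * (1 / 2 *
    ∑ w : Bool, sgn (v && x.1 q) * sgn (v && w) * σ b x (upd (flip D x) q w)))
  refine Eq.trans ?_ (key.trans ?_)
  · refine Finset.sum_congr rfl fun x _ => ?_
    have h1 : ∀ w, ∏ u ∈ A, sgn ((upd x q w).1 u) = ∏ u ∈ A, sgn (x.1 u) := fun w =>
      Finset.prod_congr rfl fun u hu => by
        rw [show (upd x q w).1 u = x.1 u from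
          Function.update_of_ne (by rintro rfl; exact hA hu) _ _]
    have h2 : ∀ v w, upd (flip D (upd x q v)) q w = upd (flip D x) q w := fun v w => by
      refine Prod.ext (funext fun u => ?_) rfl
      by_cases hu : u = q
      · subst hu
        simp [upd]
      · simp [upd, flip, hu]
    have h3 : (flip D x).1 q = x.1 q := by simp [flip, hD]
    have h4 : ∀ w, (upd x q w).1 q = w := fun w => by simp [upd]
    simp only [apply_hadamard, h1, h2, h3, h4, Finset.prod_insert hA]
    rw [← Finset.mul_sum, ← Finset.mul_sum, ← Finset.mul_sum]
    ring
  · refine Finset.sum_congr rfl fun x _ => ?_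
    have h : flip (insert q D) x = upd (flip D x) q (!x.1 q) := by
      refine Prod.ext (funext fun u => ?_) rfl
      by_cases hu : u = q
      · subst hu
        simp [upd, flip]
      · simp [upd, flip, hu]
    rw [h]
    cases x.1 q <;> simp [sgn] <;> ring

theorem pauliTrace_foldl_hadamard {us : List (Fin a)} (hus : us.Nodup) {A D : Finset (Fin a)}
    (hA : ∀ u ∈ us, u ∉ A) (hD : ∀ u ∈ us, u ∉ D) (σ : HybridState a c m d) :
    pauliTrace (us.toFinset ∪ A) D
      ((us.map fun u => (Op.hadamard u : Op a c m)).foldl (fun σ o => o.apply σ) σ) =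
      pauliTrace A (us.toFinset ∪ D) σ := by
  induction us generalizing A σ with
  | nil => simp
  | cons u us ih =>
    rw [List.nodup_cons] at hus
    rw [List.map_cons, List.foldl_cons, List.toFinset_cons, Finset.insert_union,
      ← Finset.union_insert, ih hus.2, pauliTrace_apply_hadamard, Finset.insert_union]
    · exact hA u List.mem_cons_self
    · simp [hus.1, hD u List.mem_cons_self]
    · intro w hw
      rw [Finset.mem_insert, not_or]
      exact ⟨fun h => hus.1 (h ▸ hw), hA w (List.mem_cons_of_mem _ hw)⟩
    · exact fun w hw => hD w (List.mem_cons_of_mem _ hw)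

theorem signTrace_empty (A : Finset (Fin a)) (σ : HybridState a a m d) :
    signTrace A ∅ σ = pauliTrace A ∅ σ := by
  simp [signTrace, pauliTrace, flip]

/-! ### Parities -/

theorem parity_insert {s : Finset (Fin c)} {u : Fin c} (hu : u ∉ s) (b : Fin c → Bool) :
    parity (insert u s) b = xor (parity s b) (b u) := by
  rw [parity, parity, Finset.filter_insert]
  cases h : b u
  · simp
  · have h1 : u ∉ s.filter fun i => b i = true := fun h => hu (Finset.mem_filter.mp h).1
    simp only [if_true, Finset.card_insert_of_notMem h1, Bool.xor_true, ← decide_not,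
      Nat.odd_add_one]

theorem sgn_xor (v w : Bool) : sgn (xor v w) = sgn v * sgn w := by
  cases v <;> cases w <;> simp [sgn]

theorem sgn_parity (s : Finset (Fin c)) (b : Fin c → Bool) :
    sgn (parity s b) = ∏ u ∈ s, sgn (b u) := by
  induction s using Finset.induction_on with
  | empty => simp [parity, sgn]
  | insert u s hu ih => rw [parity_insert hu, sgn_xor, ih, Finset.prod_insert hu, mul_comm]

end QCircuit

/-! ## The circuit -/

namespace QCircuit

/-- The trace of a matrix power as a sum over cyclic words. -/
theorem sum_chain {ι : Type*} [Fintype ι] [DecidableEq ι] (M : Matrix ι ι ℂ) (m : ℕ)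
    (F : ι → ι → ℂ) :
    ∑ y : Fin (m + 1) → ι, F (y 0) (y (Fin.last m)) * ∏ i : Fin m, M (y i.castSucc) (y i.succ) =
      ∑ u, ∑ v, F u v * (M ^ m) u v := by
  induction m generalizing F with
  | zero =>
    rw [← (Equiv.funUnique (Fin 1) ι).symm.sum_comp]
    simp [Matrix.one_apply]
  | succ m ih =>
    rw [← (Fin.consEquiv fun _ : Fin (m + 2) => ι).sum_comp, Fintype.sum_prod_type]
    refine Finset.sum_congr rfl fun u _ => ?_
    -- The first letter is split off and its edge absorbed into the weight; `F` is arbitrary to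
    -- allow this.
    have h := ih fun p q => F u q * M u p
    refine Eq.trans ?_ (h.trans ?_)
    · refine Finset.sum_congr rfl fun y _ => ?_
      rw [Fin.prod_univ_succ]
      simp only [Fin.consEquiv_apply, ← Fin.succ_last, Fin.cons_succ, ← Fin.succ_castSucc,
        Fin.cons_zero, Fin.castSucc_zero]
      ring
    · rw [Finset.sum_comm]
      refine Finset.sum_congr rfl fun v _ => ?_
      rw [pow_succ', Matrix.mul_apply, Finset.mul_sum]
      exact Finset.sum_congr rfl fun p _ => by ring

theorem sum_cycle {ι : Type*} [Fintype ι] [DecidableEq ι] (M : Matrix ι ι ℂ) (m : ℕ) :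
    ∑ y : Fin (m + 1) → ι, ∏ i, M (y i) (y (i + 1)) = (M ^ (m + 1)).trace := by
  have h := sum_chain M m fun u v => M v u
  rw [pow_succ', Matrix.trace_mul_comm, Matrix.trace]
  refine Eq.trans ?_ (h.trans ?_)
  · refine Finset.sum_congr rfl fun y _ => ?_
    rw [Fin.prod_univ_castSucc, mul_comm]
    simp [Fin.coeSucc_eq_succ]
  · refine Finset.sum_congr rfl fun u _ => ?_
    rw [Matrix.diag_apply, Matrix.mul_apply]
    exact Finset.sum_congr rfl fun v _ => mul_comm _ _

/-- The cyclic shift is a product of two reflections. Each reflection is an involution, hence a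
single layer of disjoint swaps. -/
theorem neg_rev_eq_add_one {m : ℕ} (i : Fin (m + 1)) : -i.rev = i + 1 := by
  rw [← Fin.last_sub, neg_sub, sub_eq_add_neg]
  congr 1
  rw [neg_eq_iff_add_eq_zero, Fin.last_add_one]

section Construction

variable (n : ℕ)

/-- The qubits of the cat state. -/
def catQubit (i : Fin (n + 1)) : Fin (n + 1 + n) := Fin.castAdd n i

/-- The qubits used to link neighbouring qubits of the cat state. -/
def linkQubit (i : Fin n) : Fin (n + 1 + n) := Fin.natAdd (n + 1) i

theorem catQubit_injective : Function.Injective (catQubit n) := Fin.castAdd_injective _ _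

theorem linkQubit_injective : Function.Injective (linkQubit n) := Fin.natAdd_injective _ _

theorem catQubit_ne_linkQubit (i : Fin (n + 1)) (k : Fin n) : catQubit n i ≠ linkQubit n k := by
  intro h
  have := congrArg Fin.val h
  simp only [catQubit, linkQubit, Fin.val_castAdd, Fin.val_natAdd] at this
  omega

theorem exists_catQubit_or_linkQubit (u : Fin (n + 1 + n)) :
    (∃ i, catQubit n i = u) ∨ ∃ k, linkQubit n k = u := by
  induction u using Fin.addCases with
  | left i => exact Or.inl ⟨i, rfl⟩
  | right i => exact Or.inr ⟨i, rfl⟩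

/-- The list of the qubits of the cat state. -/
def catList : List (Fin (n + 1 + n)) := (List.finRange (n + 1)).map (catQubit n)

/-- The list of the link qubits. -/
def linkList : List (Fin (n + 1 + n)) := (List.finRange n).map (linkQubit n)

theorem catList_nodup : (catList n).Nodup := (List.nodup_finRange _).map (catQubit_injective n)

theorem linkList_nodup : (linkList n).Nodup := (List.nodup_finRange _).map (linkQubit_injective n)

theorem mem_catList {u : Fin (n + 1 + n)} : u ∈ catList n ↔ ∃ i, catQubit n i = u := by
  simp [catList]

theorem mem_linkList {u : Fin (n + 1 + n)} : u ∈ linkList n ↔ ∃ i, linkQubit n i = u := by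
  simp [linkList]

/-- The classical bits whose parity is the correction of the `i`-th qubit of the cat state. -/
def correction (i : Fin (n + 1)) : Finset (Fin (n + 1 + n)) :=
  (Finset.univ.filter fun k : Fin n => k.castSucc < i).image (linkQubit n)

theorem correction_succ (k : Fin n) :
    correction n k.succ = insert (linkQubit n k) (correction n k.castSucc) := by
  rw [correction, correction, ← Finset.image_insert]
  congr 1
  ext j
  simp only [Finset.mem_filter, Finset.mem_univ, true_and, Finset.mem_insert, Fin.lt_def,
    Fin.val_castSucc, Fin.val_succ, Fin.ext_iff]
  omega

/-- The corrections of neighbours differ by the outcome of the link between them, which is their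
relative flip. -/
theorem parity_correction_succ (k : Fin n) (b : Fin (n + 1 + n) → Bool) :
    parity (correction n k.succ) b = xor (parity (correction n k.castSucc) b) (b (linkQubit n k)) := by
  rw [correction_succ, parity_insert]
  intro h
  simp only [correction, Finset.mem_image, Finset.mem_filter, Finset.mem_univ, true_and] at h
  obtain ⟨j, h1, h2⟩ := h
  rw [linkQubit_injective n h2] at h1
  exact lt_irrefl _ h1

/-- The control qubit of the swap that starts at a register. -/
def controlQubit (i : Fin n) : Fin (n + 1 + n) := catQubit n i.castSucc

/-- Hadamard gates on the cat qubits. -/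
def hadamardLayer : List (Op (n + 1 + n) (n + 1 + n) n) := (catList n).map fun u => Op.hadamard u

/-- `CNOT` gates from the cat qubits to the next links. -/
def linkLayer₁ : List (Op (n + 1 + n) (n + 1 + n) n) :=
  (List.finRange n).map fun i =>
    Op.cnot (catQubit n i.castSucc) (linkQubit n i) (catQubit_ne_linkQubit n _ _)

/-- `CNOT` gates from the cat qubits to the previous links. -/
def linkLayer₂ : List (Op (n + 1 + n) (n + 1 + n) n) :=
  (List.finRange n).map fun i =>
    Op.cnot (catQubit n i.succ) (linkQubit n i) (catQubit_ne_linkQubit n _ _)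

/-- Measurement of the links. -/
def linkMeasureLayer : List (Op (n + 1 + n) (n + 1 + n) n) :=
  (linkList n).map fun u => Op.measure u u

/-- Correction of the cat state. -/
def correctionLayer : List (Op (n + 1 + n) (n + 1 + n) n) :=
  (List.finRange (n + 1)).map fun i => Op.condX (catQubit n i) (correction n i)

/-- Controlled swaps that carry out an involution of the registers. -/
def swapLayer (s : Fin n → Fin n) : List (Op (n + 1 + n) (n + 1 + n) n) :=
  (List.finRange n).filterMap (swapOp (controlQubit n) s)

/-- Measurement of the cat qubits. -/
def catMeasureLayer : List (Op (n + 1 + n) (n + 1 + n) n) :=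
  (catList n).map fun u => Op.measure u u

/-- The layers of the circuit. -/
def cycleLayers : List (List (Op (n + 1 + n) (n + 1 + n) n)) :=
  [hadamardLayer n, linkLayer₁ n, linkLayer₂ n, linkMeasureLayer n, correctionLayer n,
    swapLayer n Fin.rev, swapLayer n (fun i => -i), hadamardLayer n, catMeasureLayer n]

theorem neg_involutive : Function.Involutive (fun i : Fin n => -i) := by
  intro i
  cases n with
  | zero => exact i.elim0
  | succ n => exact neg_neg i

theorem pairwise_map_finRange {α : Type*} {R : α → α → Prop} {k : ℕ} {f : Fin k → α}
    (h : ∀ i j, i ≠ j → R (f i) (f j)) : ((List.finRange k).map f).Pairwise R :=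
  List.pairwise_map.mpr ((List.nodup_finRange k).imp fun {i j} hij => h i j hij)

/-- Only the smaller element of a two-cycle starts a swap, so different gates use disjoint pairs of
registers; each gate has a control qubit of its own. -/
theorem pairwise_swapLayer {s : Fin n → Fin n} (hs : Function.Involutive s) :
    (swapLayer n s).Pairwise Op.Parallel := by
  refine List.pairwise_filterMap.mpr ((List.nodup_finRange n).imp fun {i j} hij => ?_)
  intro o ho o' ho'
  simp only [swapOp, Option.dite_none_right_eq_some, Option.some.injEq] at ho ho'
  obtain ⟨hi, rfl⟩ := ho
  obtain ⟨hj, rfl⟩ := ho'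
  have h1 : controlQubit n i ≠ controlQubit n j := fun h =>
    hij (Fin.castSucc_injective n (catQubit_injective n h))
  have h2 : s i ≠ s j := fun h => hij (hs.injective h)
  have h3 : i ≠ s j := by
    rintro rfl
    rw [hs] at hi
    exact lt_asymm hi hj
  have h4 : j ≠ s i := by
    rintro rfl
    rw [hs] at hj
    exact lt_asymm hi hj
  simp [Op.Parallel, Op.qubits, Op.registers, Op.writes, h1, h2.symm, hij.symm, h3.symm, h4]

theorem parallel_cycleLayers : ∀ L ∈ cycleLayers n, L.Pairwise Op.Parallel := by
  have hc : ∀ i j, i ≠ j → catQubit n j ≠ catQubit n i := fun i j hij h =>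
    hij (catQubit_injective n h).symm
  have hl : ∀ i j, i ≠ j → linkQubit n j ≠ linkQubit n i := fun i j hij h =>
    hij (linkQubit_injective n h).symm
  have hcl := catQubit_ne_linkQubit n
  have h1 : (hadamardLayer n).Pairwise Op.Parallel := by
    rw [hadamardLayer, catList, List.map_map]
    refine pairwise_map_finRange fun i j hij => ?_
    simp [Op.Parallel, Op.qubits, Op.registers, Op.writes, (hc i j hij).symm]
  intro L hL
  simp only [cycleLayers, List.mem_cons, List.not_mem_nil, or_false] at hL
  rcases hL with rfl | rfl | rfl | rfl | rfl | rfl | rfl | rfl | rfl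
  · exact h1
  · refine pairwise_map_finRange fun i j hij => ?_
    simp [Op.Parallel, Op.qubits, Op.registers, Op.writes, hl i j hij, hcl, (hcl _ _).symm,
      hc _ _ (fun h => hij (Fin.castSucc_injective n h))]
  · refine pairwise_map_finRange fun i j hij => ?_
    simp [Op.Parallel, Op.qubits, Op.registers, Op.writes, hl i j hij, hcl, (hcl _ _).symm,
      hc _ _ (fun h => hij (Fin.succ_injective n h))]
  · rw [linkMeasureLayer, linkList, List.map_map]
    refine pairwise_map_finRange fun i j hij => ?_
    simp [Op.Parallel, Op.qubits, Op.registers, Op.writes, Op.reads, hl i j hij,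
      (hl i j hij).symm]
  · refine pairwise_map_finRange fun i j hij => ?_
    simp [Op.Parallel, Op.qubits, Op.registers, Op.writes, (hc i j hij).symm]
  · exact pairwise_swapLayer n Fin.rev_involutive
  · exact pairwise_swapLayer n (neg_involutive n)
  · exact h1
  · rw [catMeasureLayer, catList, List.map_map]
    refine pairwise_map_finRange fun i j hij => ?_
    simp [Op.Parallel, Op.qubits, Op.registers, Op.writes, Op.reads, hc i j hij,
      (hc i j hij).symm]

/-- The circuit on `n` copies whose results have expectation `Tr(ρ ^ n)`: the cyclic shift of the
registers, controlled by a cat state that is prepared in constant depth. -/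
def cycleCircuit : QCircuit n where
  ancillas := n + 1 + n
  cbits := n + 1 + n
  layers := cycleLayers n
  parallel := parallel_cycleLayers n
  output := (catList n).toFinset

theorem countP_map_eq_zero {α β : Type*} {p : β → Bool} {f : α → β} {l : List α}
    (h : ∀ x, p (f x) = false) : (l.map f).countP p = 0 := by
  rw [List.countP_eq_zero]
  intro y hy
  obtain ⟨x, -, rfl⟩ := List.mem_map.mp hy
  simp [h]

theorem countP_swapLayer_le (s : Fin n → Fin n) : (swapLayer n s).countP Op.isCSwap ≤ n :=
  List.countP_le_length.trans ((List.length_filterMap_le _ _).trans (by simp))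

theorem cswapCount_cycleCircuit_le : (cycleCircuit n).cswapCount ≤ 2 * n := by
  have h1 := countP_swapLayer_le n Fin.rev
  have h2 := countP_swapLayer_le n fun i => -i
  rw [cswapCount, cycleCircuit]
  simp only [cycleLayers, List.flatten_cons, List.flatten_nil, List.countP_append, hadamardLayer,
    linkLayer₁, linkLayer₂, linkMeasureLayer, correctionLayer, catMeasureLayer]
  rw [countP_map_eq_zero fun _ => rfl, countP_map_eq_zero fun _ => rfl,
    countP_map_eq_zero fun _ => rfl, countP_map_eq_zero fun _ => rfl,
    countP_map_eq_zero fun _ => rfl, countP_map_eq_zero fun _ => rfl, List.countP_nil]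
  omega

theorem resources_cycleCircuit {j : ℕ} (hj : 1 ≤ j) :
    (cycleCircuit j).depth ≤ 9 ∧ (cycleCircuit j).cswapCount ≤ 9 * j ∧
      ∀ n, (cycleCircuit j).numQubits n ≤ n * j + 9 * j := by
  -- Nine is the number of layers; it also covers the `2 j + 1` ancillas and the at most `2 j`
  -- swaps.
  refine ⟨le_rfl, (cswapCount_cycleCircuit_le j).trans (by omega), fun n => ?_⟩
  have : (cycleCircuit j).numQubits n = j + 1 + j + j * n := rfl
  rw [this, mul_comm j n]
  omega

end Construction

end QCircuit

/-! ### The expected result of the circuit -/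

namespace QCircuit

section Expectation

variable {m d : ℕ}

theorem sum_runPMF_mul_signValue (C : QCircuit m) (ρ : DensityMatrix d) :
    ∑ x, (C.runPMF ρ x).toReal * signValue x =
      (∑ b, sgn (parity C.output b) * (C.finalState ρ b).trace).re := by
  have hp : ∀ b, (C.memoryPMF ρ b).toReal = ((C.finalState ρ b).trace).re := fun b => by
    rw [memoryPMF, PMF.ofFintype_apply, ENNReal.toReal_ofReal]
    exact (Complex.le_def.mp ((isNormalized_finalState C ρ).1 b).trace_nonneg).1
  have hr : ∀ x, (C.runPMF ρ x).toReal =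
      ∑ b, if x = parity C.output b then ((C.finalState ρ b).trace).re else 0 := fun x => by
    rw [runPMF, PMF.map_apply, tsum_fintype, ENNReal.toReal_sum]
    · refine Finset.sum_congr rfl fun b _ => ?_
      rw [← hp b]
      split_ifs <;> simp
    · intro b _
      split_ifs
      · exact PMF.apply_ne_top _ _
      · simp
  rw [Complex.re_sum]
  simp only [hr, Finset.sum_mul]
  rw [Finset.sum_comm]
  refine Finset.sum_congr rfl fun b _ => ?_
  cases parity C.output b <;> simp [signValue, sgn]

end Expectation

/-! ### The cat state and the expectation of its parity -/

section Cat

variable {n d : ℕ} (ρ : DensityMatrix d)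

/-- The set of the cat qubits. -/
def catSet (n : ℕ) : Finset (Fin (n + 1 + n)) := (catList n).toFinset

/-- The set of the link qubits. -/
def linkSet (n : ℕ) : Finset (Fin (n + 1 + n)) := (linkList n).toFinset

theorem mem_catSet {u : Fin (n + 1 + n)} : u ∈ catSet n ↔ ∃ i, catQubit n i = u := by
  rw [catSet, List.mem_toFinset, mem_catList]

theorem mem_linkSet {u : Fin (n + 1 + n)} : u ∈ linkSet n ↔ ∃ i, linkQubit n i = u := by
  rw [linkSet, List.mem_toFinset, mem_linkList]

theorem notMem_catSet {u : Fin (n + 1 + n)} : u ∉ catSet n ↔ ∃ i, linkQubit n i = u := by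
  rw [mem_catSet]
  constructor
  · intro h
    exact (exists_catQubit_or_linkQubit n u).resolve_left h
  · rintro ⟨k, rfl⟩ ⟨i, hi⟩
    exact catQubit_ne_linkQubit n i k hi

theorem notMem_linkSet {u : Fin (n + 1 + n)} : u ∉ linkSet n ↔ ∃ i, catQubit n i = u := by
  rw [mem_linkSet]
  constructor
  · intro h
    exact (exists_catQubit_or_linkQubit n u).resolve_right h
  · rintro ⟨k, rfl⟩ ⟨i, hi⟩
    exact catQubit_ne_linkQubit n k i hi.symm

theorem card_catSet : (catSet n).card = n + 1 := by
  rw [catSet, List.toFinset_card_of_nodup (catList_nodup n), catList, List.length_map,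
    List.length_finRange]

/-- The basis permutation of the two linking layers. -/
def linkMap (b : Fin (n + 1 + n) → Bool) (x : Basis (n + 1 + n) n d) : Basis (n + 1 + n) n d :=
  pullList b (linkLayer₁ n) (pullList b (linkLayer₂ n) x)

theorem linkMap_snd (b : Fin (n + 1 + n) → Bool) (x : Basis (n + 1 + n) n d) :
    (linkMap b x).2 = x.2 :=
  (pullList_cnot_snd (h := fun _ _ => catQubit_ne_linkQubit n _ _) b (List.finRange n) _).trans
    (pullList_cnot_snd (h := fun _ _ => catQubit_ne_linkQubit n _ _) b (List.finRange n) _)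

theorem linkMap_link (b : Fin (n + 1 + n) → Bool) (x : Basis (n + 1 + n) n d) (k : Fin n) :
    (linkMap b x).1 (linkQubit n k) = xor (x.1 (catQubit n k.castSucc))
      (xor (x.1 (catQubit n k.succ)) (x.1 (linkQubit n k))) := by
  have h1 := pullList_cnot_target (m := n) (p := fun i : Fin n => catQubit n i.castSucc)
    (h := fun _ _ => catQubit_ne_linkQubit n _ _) (linkQubit_injective n) b
    (List.nodup_finRange n) (pullList b (linkLayer₂ n) x) k
  have h2 := pullList_cnot_target (m := n) (p := fun i : Fin n => catQubit n i.succ)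
    (h := fun _ _ => catQubit_ne_linkQubit n _ _) (linkQubit_injective n) b
    (List.nodup_finRange n) x k
  have h3 := pullList_cnot_of_notMem (m := n) (p := fun i : Fin n => catQubit n i.succ)
    (t := linkQubit n) (h := fun _ _ => catQubit_ne_linkQubit n _ _) b
    (List.finRange n) x (u := catQubit n k.castSucc) fun i => (catQubit_ne_linkQubit n _ _).symm
  rw [if_pos (List.mem_finRange k)] at h1 h2
  refine h1.trans ?_
  exact congrArg₂ _ h3 h2

/-- The basis permutation of the correction and of the controlled swaps. -/
def shiftMap (b : Fin (n + 1 + n) → Bool) (x : Basis (n + 1 + n) n d) : Basis (n + 1 + n) n d :=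
  pullList b (correctionLayer n) (pullList b (swapLayer n Fin.rev)
    (pullList b (swapLayer n fun i => -i) x))

theorem swapLayers_fst (b : Fin (n + 1 + n) → Bool) (x : Basis (n + 1 + n) n d) :
    (pullList b (swapLayer n Fin.rev) (pullList b (swapLayer n fun i => -i) x)).1 = x.1 :=
  (pullList_swapOp_fst b _ _).trans (pullList_swapOp_fst b _ _)

theorem shiftMap_link (b : Fin (n + 1 + n) → Bool) (x : Basis (n + 1 + n) n d) (k : Fin n) :
    (shiftMap b x).1 (linkQubit n k) = x.1 (linkQubit n k) := by
  have h := pullList_condX_of_notMem (q := catQubit n) (s := correction n) b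
    (List.finRange (n + 1)) (pullList b (swapLayer n Fin.rev)
    (pullList b (swapLayer n fun i => -i) x)) (u := linkQubit n k)
    fun i => catQubit_ne_linkQubit n i k
  rw [swapLayers_fst] at h
  exact h

theorem shiftMap_cat (b : Fin (n + 1 + n) → Bool) (x : Basis (n + 1 + n) n d) (i : Fin (n + 1)) :
    (shiftMap b x).1 (catQubit n i) = xor (parity (correction n i) b) (x.1 (catQubit n i)) := by
  have h := pullList_condX_target (q := catQubit n) (s := correction n) (catQubit_injective n) b
    (List.nodup_finRange (n + 1)) (pullList b (swapLayer n Fin.rev)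
    (pullList b (swapLayer n fun i => -i) x)) i
  rw [swapLayers_fst, if_pos (List.mem_finRange i)] at h
  exact h

theorem shiftMap_snd (b : Fin (n + 1 + n) → Bool) (x : Basis (n + 1 + n) n d) {v : Bool}
    (hx : ∀ i, x.1 (catQubit n i) = v) (u : Fin n) :
    (shiftMap b x).2 u = if v then x.2 (-u.rev) else x.2 u := by
  have h1 := pullList_condX_snd (q := catQubit n) (s := correction n) b
    (List.finRange (n + 1)) (pullList b (swapLayer n Fin.rev)
    (pullList b (swapLayer n fun i => -i) x))
  have h2 := pullList_swapOp_finRange (q := controlQubit n) (neg_involutive n) b x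
    (v := v) fun i => hx _
  have h3 := pullList_swapOp_finRange (q := controlQubit n) Fin.rev_involutive b
    (pullList b (swapLayer n fun i => -i) x) (v := v) fun i => by
      rw [show (pullList b (swapLayer n fun i => -i) x).1 = x.1 from pullList_swapOp_fst b _ _]
      exact hx _
  refine (congrFun h1 u).trans ((h3 u).trans ?_)
  split_ifs with hv
  · exact (h2 u.rev).trans (if_pos hv)
  · exact (h2 u).trans (if_neg hv)

/-- The joint state of qubits and registers before the links are measured. -/
noncomputable def linkedOperator : Operator (n + 1 + n) n d := Matrix.of fun x y =>
  if ∀ k, (linkMap (fun _ => false) x).1 (linkQubit n k) = false ∧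
      (linkMap (fun _ => false) y).1 (linkQubit n k) = false then
    (1 / 2) ^ (n + 1) * ∏ i, ρ.mat (x.2 i) (y.2 i) else 0

/-- The hybrid state before the final Hadamard gates. -/
noncomputable def shiftedState : HybridState (n + 1 + n) (n + 1 + n) n d := fun b =>
  Matrix.of fun x y =>
    measuredState (linkedOperator ρ) (linkSet n) b (shiftMap b x) (shiftMap b y)

theorem finalState_cycleCircuit :
    (cycleCircuit n).finalState ρ = (catMeasureLayer n).foldl (fun σ o => o.apply σ)
      ((hadamardLayer n).foldl (fun σ o => o.apply σ) (shiftedState ρ)) := by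
  have h1 : (hadamardLayer n).foldl (fun σ o => o.apply σ)
      (initState (n + 1 + n) (n + 1 + n) n ρ) = uniformState ρ (catSet n) := by
    rw [initState_eq_uniformState, hadamardLayer,
      foldl_hadamard_uniformState ρ (catList_nodup n) (by simp), Finset.union_empty]
    rfl
  have h2 : (linkLayer₂ n).foldl (fun σ o => o.apply σ) ((linkLayer₁ n).foldl
      (fun σ o => o.apply σ) (uniformState ρ (catSet n))) =
      measuredState (linkedOperator ρ) ∅ := by
    ext b x y
    rw [foldl_of_isReversible, foldl_of_isReversible]
    · change uniformState ρ (catSet n) b (linkMap b x) (linkMap b y) = _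
      by_cases hb : b = fun _ => false
      · subst hb
        simp only [uniformState, measuredState, linkedOperator, Matrix.of_apply, true_and,
          Finset.notMem_empty, not_false_eq_true, IsEmpty.forall_iff, implies_true, and_true,
          if_true, card_catSet, linkMap_snd, notMem_catSet, forall_exists_index,
          forall_apply_eq_imp_iff]
      · have : ¬ ∀ u, b u = false := fun h => hb (funext h)
        simp [uniformState, measuredState, hb, this]
    · simp [linkLayer₁, Op.IsReversible]
    · simp [linkLayer₂, Op.IsReversible]
  have h3 : (linkMeasureLayer n).foldl (fun σ o => o.apply σ) (measuredState (linkedOperator ρ) ∅) =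
      measuredState (linkedOperator ρ) (linkSet n) := by
    rw [linkMeasureLayer, foldl_measure_measuredState _ (linkList_nodup n) (by simp),
      Finset.union_empty]
    rfl
  have hswap : ∀ s : Fin n → Fin n, ∀ o ∈ swapLayer n s, o.IsReversible := by
    intro s o ho
    obtain ⟨i, -, hi⟩ := List.mem_filterMap.mp ho
    simp only [swapOp, Option.dite_none_right_eq_some, Option.some.injEq] at hi
    obtain ⟨h, rfl⟩ := hi
    trivial
  have h4 : (swapLayer n fun i => -i).foldl (fun σ o => o.apply σ) ((swapLayer n Fin.rev).foldl
      (fun σ o => o.apply σ) ((correctionLayer n).foldl (fun σ o => o.apply σ)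
        (measuredState (linkedOperator ρ) (linkSet n)))) = shiftedState ρ := by
    ext b x y
    rw [foldl_of_isReversible (hswap _), foldl_of_isReversible (hswap _), foldl_of_isReversible]
    · rfl
    · simp [correctionLayer, Op.IsReversible]
  rw [← h4, ← h3, ← h2, ← h1]
  simp only [finalState, cycleCircuit, cycleLayers, List.flatten_cons, List.flatten_nil,
    List.foldl_append, List.append_nil]

/-- The last two layers measure `X` on every cat qubit, so only entries between a basis vector and
its flip count. -/
theorem sum_parity_finalState :
    ∑ b, sgn (parity (cycleCircuit n).output b) * ((cycleCircuit n).finalState ρ b).trace =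
      ∑ b, ∑ x, shiftedState ρ b x (flip (catSet n) x) := by
  have h1 : ∑ b, sgn (parity (cycleCircuit n).output b) *
      ((cycleCircuit n).finalState ρ b).trace =
      signTrace ∅ (catSet n) ((cycleCircuit n).finalState ρ) := by
    refine Finset.sum_congr rfl fun b _ => ?_
    rw [sgn_parity, Matrix.trace, Finset.mul_sum]
    refine Finset.sum_congr rfl fun x _ => ?_
    rw [Finset.prod_empty, one_mul]
    rfl
  have h2 := signTrace_foldl_measure (catList_nodup n) (A := ∅) (B := ∅) (by simp) (by simp)
    ((hadamardLayer n).foldl (fun σ o => o.apply σ) (shiftedState ρ))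
  have h3 := pauliTrace_foldl_hadamard (catList_nodup n) (A := ∅) (D := ∅) (by simp) (by simp)
    (shiftedState ρ)
  simp only [Finset.union_empty] at h2 h3
  rw [h1, finalState_cycleCircuit]
  refine h2.trans ((signTrace_empty _ _).trans (h3.trans ?_))
  simp [pauliTrace, catSet]

/-- The bits with value `v` on the cat and `β` on the links. -/
def bits (v : Bool) (β : Fin n → Bool) : Fin (n + 1 + n) → Bool :=
  Fin.append (fun _ : Fin (n + 1) => v) β

theorem bits_cat (v : Bool) (β : Fin n → Bool) (i : Fin (n + 1)) :
    bits v β (catQubit n i) = v := Fin.append_left _ _ _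

theorem bits_link (v : Bool) (β : Fin n → Bool) (k : Fin n) :
    bits v β (linkQubit n k) = β k := Fin.append_right _ _ _

theorem eq_bits {b : Fin (n + 1 + n) → Bool} {v : Bool} (h : ∀ i, b (catQubit n i) = v) :
    b = bits v fun k => b (linkQubit n k) := by
  funext u
  rcases exists_catQubit_or_linkQubit n u with ⟨i, rfl⟩ | ⟨k, rfl⟩
  · rw [h, bits_cat]
  · rw [bits_link]

/-- This is the coherence between the two branches of the cat: the swaps fire on exactly one side of
the matrix, so one index of each factor `ρ` is shifted. -/
theorem shiftedState_bits (β : Fin n → Bool) (v : Bool) (y : Fin n → Fin d) :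
    shiftedState ρ (bits false β) (bits v β, y) (flip (catSet n) (bits v β, y)) =
      (1 / 2) ^ (n + 1) * ∏ u, ρ.mat (if v then y (-u.rev) else y u)
        (if v then y u else y (-u.rev)) := by
  have hfc : ∀ i, (flip (catSet n) ((bits v β, y) : Basis (n + 1 + n) n d)).1 (catQubit n i) =
      !v := fun i => by
    simp [flip, mem_catSet, bits_cat]
  have hfl : ∀ k, (flip (catSet n) ((bits v β, y) : Basis (n + 1 + n) n d)).1 (linkQubit n k) =
      β k := fun k => by
    have : linkQubit n k ∉ catSet n := notMem_catSet.mpr ⟨k, rfl⟩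
    simp [flip, this, bits_link]
  simp only [shiftedState, measuredState, linkedOperator, Matrix.of_apply]
  rw [if_pos, if_pos]
  · congr 1
    refine Finset.prod_congr rfl fun u _ => ?_
    rw [shiftMap_snd _ _ fun i => bits_cat v β i, shiftMap_snd _ _ hfc]
    cases v <;> simp [flip]
  · intro k
    rw [linkMap_link, linkMap_link]
    simp only [shiftMap_cat, shiftMap_link, hfc, hfl, parity_correction_succ, bits_cat, bits_link]
    cases v <;> cases β k <;> cases parity (correction n k.castSucc) (bits false β) <;> simp
  · refine ⟨fun u hu => ?_, fun u hu => ?_⟩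
    · obtain ⟨i, rfl⟩ := notMem_linkSet.mp hu
      exact bits_cat _ _ _
    · obtain ⟨k, rfl⟩ := mem_linkSet.mp hu
      rw [shiftMap_link, shiftMap_link, hfl]
      simp [bits_link]

/-- Before the correction a link outcome is the parity of its two neighbours. The corrections of
these neighbours differ by the same bit, so afterwards all cat bits agree: one cat state for each
outcome `β`. -/
theorem exists_bits_of_shiftedState_ne_zero {b : Fin (n + 1 + n) → Bool}
    {x y : Basis (n + 1 + n) n d} (h : shiftedState ρ b x y ≠ 0) :
    ∃ β v, b = bits false β ∧ x.1 = bits v β := by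
  simp only [shiftedState, measuredState, linkedOperator, Matrix.of_apply, ← ite_and, ne_eq,
    ite_eq_right_iff, Classical.not_imp] at h
  obtain ⟨⟨⟨h1, h2⟩, h3⟩, -⟩ := h
  have hl : ∀ k, x.1 (linkQubit n k) = b (linkQubit n k) := fun k => by
    rw [← shiftMap_link b x]
    exact (h2 _ (mem_linkSet.mpr ⟨k, rfl⟩)).1
  have hc : ∀ i, x.1 (catQubit n i) = x.1 (catQubit n 0) := by
    intro i
    induction i using Fin.induction with
    | zero => rfl
    | succ k ih =>
      have h4 := (h3 k).1
      rw [linkMap_link, shiftMap_cat, shiftMap_cat, shiftMap_link, hl,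
        parity_correction_succ] at h4
      rw [← ih]
      revert h4
      cases x.1 (catQubit n k.castSucc) <;> cases x.1 (catQubit n k.succ) <;>
        cases b (linkQubit n k) <;> cases parity (correction n k.castSucc) b <;> simp
  refine ⟨fun k => b (linkQubit n k), x.1 (catQubit n 0), eq_bits fun i => ?_, ?_⟩
  · exact h1 _ (notMem_linkSet.mpr ⟨i, rfl⟩)
  · refine (eq_bits hc).trans ?_
    simp only [hl]

/-- The `2^n` link outcomes contribute equally, and `2^n (1/2)^(n+1) = 1/2` averages the two
branches. -/
theorem sum_shiftedState :
    ∑ b, ∑ x, shiftedState ρ b x (flip (catSet n) x) =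
      1 / 2 * ∑ v : Bool, ∑ y : Fin n → Fin d,
        ∏ u, ρ.mat (if v then y (-u.rev) else y u) (if v then y u else y (-u.rev)) := by
  rw [← Fintype.sum_prod_type']
  have h := Fintype.sum_of_injective
    (fun p : (Fin n → Bool) × Bool × (Fin n → Fin d) =>
      ((bits false p.1, (bits p.2.1 p.1, p.2.2)) :
        (Fin (n + 1 + n) → Bool) × Basis (n + 1 + n) n d)) ?_
    (fun p => (1 / 2 : ℂ) ^ (n + 1) * ∏ u, ρ.mat (if p.2.1 then p.2.2 (-u.rev) else p.2.2 u)
        (if p.2.1 then p.2.2 u else p.2.2 (-u.rev)))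
    (fun p => shiftedState ρ p.1 p.2 (flip (catSet n) p.2)) ?_ ?_
  · rw [← h, Fintype.sum_prod_type]
    simp only [Fintype.sum_prod_type, ← Finset.mul_sum]
    rw [Finset.sum_const, Finset.card_univ, Fintype.card_fun, Fintype.card_bool, Fintype.card_fin,
      nsmul_eq_mul, ← mul_assoc]
    congr 1
    push_cast
    rw [pow_succ, mul_right_comm, ← mul_pow]
    norm_num
  · rintro ⟨β, v, y⟩ ⟨β', v', y'⟩ h
    simp only [Prod.mk.injEq] at h
    obtain ⟨h1, h2, rfl⟩ := h
    have hβ : β = β' := funext fun k => by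
      rw [← bits_link false β, h1, bits_link]
    have hv : v = v' := by
      rw [← bits_cat v β 0, h2, bits_cat]
    rw [hβ, hv]
  · rintro ⟨b, x⟩ hp
    by_contra h
    obtain ⟨β, v, hb, hx⟩ := exists_bits_of_shiftedState_ne_zero ρ h
    exact hp ⟨(β, v, x.2), Prod.ext hb.symm (Prod.ext hx.symm rfl)⟩
  · rintro ⟨β, v, y⟩
    exact (shiftedState_bits ρ β v y).symm

theorem unbiased_cycleCircuit : Estimation.Unbiased cycleCircuit := by
  intro j d ρ hj
  obtain ⟨m, rfl⟩ : ∃ m, j = m + 1 := ⟨j - 1, by omega⟩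
  rw [sum_runPMF_mul_signValue, sum_parity_finalState, sum_shiftedState, DensityMatrix.powTrace]
  congr 1
  have h1 := sum_cycle ρ.mat m
  -- The branch `v = true` runs through the cycle backwards, which amounts to transposing `ρ`.
  have h2 := sum_cycle ρ.matᵀ m
  rw [← Matrix.transpose_pow, Matrix.trace_transpose] at h2
  simp only [Matrix.transpose_apply] at h2
  simp only [Fintype.sum_bool, if_true, Bool.false_eq_true, if_false, neg_rev_eq_add_one, h1, h2]
  ring

end Cat

end QCircuit

theorem corollary1 :
    -- accuracy `ε / (k r ln r)` for `Tr(ρ ^ j)`, `j ≤ r`, suffices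
    (∀ (d : ℕ) (ρ : DensityMatrix d) (r k : ℕ) (ε : ℝ) (Q : ℕ → ℝ),
      ρ.rank = r → 2 ≤ r → 1 ≤ k → 0 < ε → ε ≤ 1 →
      (∀ j, 1 ≤ j → j ≤ r → |Q j - ρ.powTrace j| < ε / (k * r * Real.log r)) →
      ∀ i, 1 ≤ i → i ≤ k → |extendPowerSums r Q i - ρ.powTrace i| < ε) ∧
    -- circuits of constant depth with `O(j)` ancilla qubits and `O(j)` CSWAPs
    ∃ (circ : ∀ j : ℕ, QCircuit j) (K : ℕ),
      (∀ j, 1 ≤ j → (circ j).depth ≤ K ∧ (circ j).cswapCount ≤ K * j ∧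
        ∀ n, (circ j).numQubits n ≤ n * j + K * j) ∧
      -- the number of runs and of copies
      ∀ δ₀ : ℝ, 0 < δ₀ → δ₀ < 1 → ∃ C : ℝ, 0 < C ∧
        ∀ (r k : ℕ) (ε δ : ℝ), 2 ≤ r → 1 ≤ k → 0 < ε → ε ≤ 1 → 0 < δ → δ ≤ δ₀ →
          ∃ N : ℕ,
            (N : ℝ) ≤ C * (k ^ 2 * r ^ 2 * Real.log r ^ 2 / ε ^ 2 * Real.log (1 / δ)) ∧
            (∑ j ∈ Finset.Icc 1 r, (j : ℝ) * N) ≤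
              C * (k ^ 2 * r ^ 4 * Real.log r ^ 2 / ε ^ 2 * Real.log (1 / δ)) ∧
            ∀ (d : ℕ) (ρ : DensityMatrix d), ρ.rank = r →
              (∀ j, 1 ≤ j → j ≤ r →
                1 - δ ≤ (runsMeasure circ ρ r N).real
                  {ω | |empiricalPowTrace ω j - ρ.powTrace j| < ε / (k * r * Real.log r)}) ∧
              1 - δ ≤ (runsMeasure circ ρ r N).real
                {ω | ∀ i, 1 ≤ i → i ≤ k →
                  |extendPowerSums r (empiricalPowTrace ω) i - ρ.powTrace i| < ε} := by
  refine ⟨fun d ρ r k ε Q hr hr2 hk hε hε1 hQ i hi hik =>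
    ρ.sufficient_accuracy hr hr2 hk hε hε1 hQ hi hik,
    QCircuit.cycleCircuit, 9, fun j hj => QCircuit.resources_cycleCircuit hj,
    fun δ₀ hδ₀ hδ₁ => Estimation.exists_numRuns QCircuit.unbiased_cycleCircuit hδ₀ hδ₁⟩
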